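/- Let $n\ge 3$, $d\ge 0$, and let $\mathcal A=\{a_1,\dots,a_n\}$ be a set of $n$ distinct points of $\{(r,s,t)\in(\mathbb Z_{\ge 0})^3: r+s+t=d\}$ whose convex hull is two-dimensional. Write $\mathbb{TP}^{m-1}=\mathbb R^m/\mathbb R(1,\dots,1)$. For $S\subseteq\{1,\dots,n\}$ and $c\in\mathbb R^S$, the tropical plane curve with support $\{a_i\}_{i\in S}$ and coefficients $c$ is the set of $P\in\mathbb{TP}^2$ at which $\min_{i\in S}(c_i+a_i\cdot P)$ is attained at least twice; for $S=\{1,\dots,n\}$ and $c\in\mathbb{TP}^{n-1}$ it is denoted $\mathcal T(F_c)$. The regular subdivision $\Delta(c)$ of $\operatorname{conv}(\mathcal A)$ is the collection of the projections of the lower faces of the convex hull of the lifted points $(a_i,c_i)$; it is maximal if no other regular subdivision $\Delta(c')$ refines it (then $\Delta(c)$ is a triangulation of which every $a_i$ is a vertex). A tropical line $L\subset\mathbb{TP}^{n-1}$ is an embedded finite tree whose vertices all have valence at least $3$ and whose unbounded edges are labelled by leaves $1,\dots,n$ at infinity, such that the unbounded edge with leaf $i$ is a ray of direction $e_i$, and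 an edge whose removal splits the leaves into $I$ and $I^c$ has direction $e_I=\sum_{i\in I}e_i$ towards the leaves in $I$. It is trivalent if all its vertices have valence $3$. It is compatible with $\mathcal A$ if, whenever a bounded edge of $L$ separates the leaves $i\neq j$ from the leaves $k\ne l$, at least one of the segments $\operatorname{conv}(a_i,a_j)$, $\operatorname{conv}(a_k,a_l)$ is an edge of $Q=\operatorname{conv}(a_i,a_j,a_k,a_l)$, meaning that the segment lies on the boundary of $Q$ in the plane $r+s+t=d$ and contains no other of the four points $a_i,a_j,a_k,a_l$. A configuration $C$ of $n-2$ distinct points of $\mathbb{TP}^2$ is general (with respect to $\mathcal A$) if for no $i\ne j$ it lies on a tropical plane curve with support $\mathcal A\setminus\{a_i,a_j\}$, and $L_C\subset\mathbb{TP}^{n-1}$ denotes the set of all $c$ with $C\subset\mathcal T(F_c)$. **Theorem.** Let $L\subset\mathbb{TP}^{n-1}$ be a trivalent tropical line that is compatible with $\mathcal A$, and suppose that for every vertex $v$ of $L$ the regular subdivision $\Delta(v)$ of $\operatorname{conv}(\mathcal A)$ is maximal. Then there is a general configuration $C$ of $n-2$ points in $\mathbb{TP}^2$ such that $L=L_C$.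 Moreover, each $P\in C$ corresponds to a (trivalent) vertex $v$ of $L$, in the sense that there are leaves $i,j,k$ in three different components of $L\setminus\{v\}$ such that $\min_{l}(v_l+a_l\cdot P)$ is attained at $l=i,j,k$. -/

import Mathlib

noncomputable section

/-- The tropical projective space `ℝⁿ / ℝ(1,…,1)` (of dimension `n - 1`). -/
abbrev TP (n : ℕ) : Type :=
  (Fin n → ℝ) ⧸ Submodule.span ℝ ({fun _ => (1 : ℝ)} : Set (Fin n → ℝ))

/-- The class of a vector of `ℝⁿ` in tropical projective space. -/
def TP.mk {n : ℕ} (x : Fin n → ℝ) : TP n := Submodule.Quotient.mk x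

/-! ### Tropical plane curves and regular subdivisions

The support set is a family `a : Fin n → Fin 3 → ℕ` of exponent vectors. -/

/-- The exponent vector `a i`, seen as a point of `ℝ³`. -/
def realPt {n : ℕ} (a : Fin n → Fin 3 → ℕ) (i : Fin n) : Fin 3 → ℝ := fun m => (a i m : ℝ)

/-- The `i`-th term `c_i + a_i · p` of the tropical polynomial with coefficients `c`. -/
def tropTerm {n : ℕ} (a : Fin n → Fin 3 → ℕ) (c : Fin n → ℝ) (p : Fin 3 → ℝ) (i : Fin n) : ℝ :=
  c i + ∑ m, (a i m : ℝ) * p m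

/-- The indices at which the minimum of the terms `c_i + a_i · p` is attained. -/
def minTerms {n : ℕ} (a : Fin n → Fin 3 → ℕ) (c : Fin n → ℝ) (p : Fin 3 → ℝ) : Set (Fin n) :=
  {i | ∀ l, tropTerm a c p i ≤ tropTerm a c p l}

/-- The tropical projective plane curve whose support consists of the `a i` with `i ∈ S`, with
coefficients `c i`, `i ∈ S`: the points at which the minimum of `c_i + a_i · p`, `i ∈ S`, is
attained at least twice. -/
def tropCurve {n : ℕ} (a : Fin n → Fin 3 → ℕ) (S : Set (Fin n)) (c : Fin n → ℝ) : Set (TP 3) :=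
  TP.mk '' {p | ∃ i ∈ S, ∃ j ∈ S, i ≠ j ∧ tropTerm a c p i = tropTerm a c p j ∧
    ∀ l ∈ S, tropTerm a c p i ≤ tropTerm a c p l}

/-- The regular subdivision of the convex hull of the support induced by the heights `c`, as the
set of its cells of all dimensions: the projections of the lower faces of the convex hull of the
lifted points `(a i, c i)`. -/
def regularSubdivision {n : ℕ} (a : Fin n → Fin 3 → ℕ) (c : Fin n → ℝ) :
    Set (Set (Fin 3 → ℝ)) :=
  {T | ∃ p : Fin 3 → ℝ, T = convexHull ℝ (realPt a '' minTerms a c p)}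

/-- `D'` refines `D`: every cell of `D'` is contained in a cell of `D`. -/
def Refines (D' D : Set (Set (Fin 3 → ℝ))) : Prop := ∀ T' ∈ D', ∃ T ∈ D, T' ⊆ T

/-- The regular subdivision induced by `c` is maximal: no other regular subdivision (with vertices
in the support) refines it. -/
def IsMaximalSubdivision {n : ℕ} (a : Fin n → Fin 3 → ℕ) (c : Fin n → ℝ) : Prop :=
  ∀ c' : Fin n → ℝ, Refines (regularSubdivision a c') (regularSubdivision a c) →
    regularSubdivision a c' = regularSubdivision a c

/-! ### Point configurations -/

/-- The configuration `P` is general: it does not lie on any tropical curve whose support is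
obtained by removing two of the points from the support set. -/
def IsGeneral {n m : ℕ} (a : Fin n → Fin 3 → ℕ) (P : Fin m → TP 3) : Prop :=
  ∀ i j : Fin n, i ≠ j → ∀ c : Fin n → ℝ, ¬ ∀ k, P k ∈ tropCurve a {l | l ≠ i ∧ l ≠ j} c

/-- The set of all tropical curves with the full support that pass through the configuration,
as a set of coefficient vectors in tropical projective space. -/
def pencilThrough {n m : ℕ} (a : Fin n → Fin 3 → ℕ) (P : Fin m → TP 3) : Set (TP n) :=
  TP.mk '' {c | ∀ k, P k ∈ tropCurve a Set.univ c}

/-! ### Tropical lines -/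

/-- The leaves on the side of `w` of the edge `vw` of a tree, where the leaf `i` is attached to
the vertex `leaf i`. -/
def leavesBeyond {n : ℕ} {V : Type*} (G : SimpleGraph V) (leaf : Fin n → V) (v w : V) :
    Set (Fin n) :=
  {i | (G.deleteEdges {s(v, w)}).Reachable (leaf i) w}

/-- A tropical line in `ℝⁿ / ℝ(1,…,1)`: an embedded tree with `n` unbounded edges, labelled by the
leaves `1, …, n` at infinity. `V` is the set of its (finite) vertices, `graph` is the tree formed
by its bounded edges, and `leaf i` is the vertex from which the unbounded edge with leaf `i`
starts. -/
structure TropicalLine (n : ℕ) (V : Type*) [Finite V] where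
  /-- the bounded edges -/
  graph : SimpleGraph V
  isTree : graph.IsTree
  /-- the end point of the unbounded edge with the given leaf -/
  leaf : Fin n → V
  /-- the position of the vertices -/
  pos : V → TP n
  /-- every vertex lies on at least three edges, bounded or not -/
  three_le_valence : ∀ v, 3 ≤ (graph.neighborSet v).ncard + {i | leaf i = v}.ncard
  /-- a bounded edge has the direction `e_I`, where `I` is the set of leaves at its far side -/
  direction : ∀ v w, graph.Adj v w → ∃ t : ℝ, 0 < t ∧
    pos w = pos v + t • TP.mk ((leavesBeyond graph leaf v w).indicator fun _ => (1 : ℝ))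

namespace TropicalLine

variable {n : ℕ} {V : Type*} [Finite V] (L : TropicalLine n V)

/-- The points of a tropical line: its bounded edges, and for every leaf `i` the ray with
direction `e_i`. -/
def carrier : Set (TP n) :=
  {x | ∃ v w, L.graph.Adj v w ∧ x ∈ segment ℝ (L.pos v) (L.pos w)} ∪
  {x | ∃ (i : Fin n) (t : ℝ), 0 ≤ t ∧ x = L.pos (L.leaf i) + t • TP.mk (Pi.single i 1)}

/-- The number of edges, bounded or not, at a vertex. -/
def valence (v : V) : ℕ := (L.graph.neighborSet v).ncard + {i | L.leaf i = v}.ncard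

/-- Every vertex lies on exactly three edges. -/
def IsTrivalent : Prop := ∀ v, L.valence v = 3

/-- `(ij|kl)` is a trivalent subtree: some bounded edge separates the two leaves `i, j` from the
two leaves `k, l`. -/
def IsQuartet (i j k l : Fin n) : Prop :=
  i ≠ j ∧ k ≠ l ∧ ∃ v w, L.graph.Adj v w ∧
    i ∈ leavesBeyond L.graph L.leaf w v ∧ j ∈ leavesBeyond L.graph L.leaf w v ∧
    k ∈ leavesBeyond L.graph L.leaf v w ∧ l ∈ leavesBeyond L.graph L.leaf v w

/-- The leaves `i` and `j` belong to different components of the complement of the vertex `v`: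
every path joining them passes through `v`. -/
def Separates (v : V) (i j : Fin n) : Prop :=
  i ≠ j ∧ ∀ p : L.graph.Walk (L.leaf i) (L.leaf j), v ∈ p.support

end TropicalLine

/-! ### Compatibility -/

/-- The segment joining `a i` and `a j` is an edge of the convex hull of `a i, a j, a k, a l`: it
lies on the boundary of the hull (there is a line through `a i` and `a j`, in the plane that
contains the support, with the hull on one side) and it joins points that are neighbours on the
boundary (neither `a k` nor `a l` lies on the segment). -/
def IsHullEdge {n : ℕ} (a : Fin n → Fin 3 → ℕ) (i j k l : Fin n) : Prop :=
  (∃ p : Fin 3 → ℝ, TP.mk p ≠ 0 ∧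
    p ⬝ᵥ realPt a i = p ⬝ᵥ realPt a j ∧
    p ⬝ᵥ realPt a i ≤ p ⬝ᵥ realPt a k ∧ p ⬝ᵥ realPt a i ≤ p ⬝ᵥ realPt a l) ∧
  realPt a k ∉ segment ℝ (realPt a i) (realPt a j) ∧
  realPt a l ∉ segment ℝ (realPt a i) (realPt a j)

/-- The tropical line `L` is compatible with the support set. -/
def TropicalLine.IsCompatible {n : ℕ} {V : Type*} [Finite V] (L : TropicalLine n V)
    (a : Fin n → Fin 3 → ℕ) : Prop :=
  ∀ i j k l, L.IsQuartet i j k l → IsHullEdge a i j k l ∨ IsHullEdge a k l i j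

/-- The point `P` of the plane corresponds to the vertex `v` of `L`: there are three leaves in
pairwise different components of `L ∖ {v}` whose terms attain the minimum, at `P`, of the tropical
polynomial with coefficients `v`. -/
def TropicalLine.Corresponds {n : ℕ} {V : Type*} [Finite V] (L : TropicalLine n V)
    (a : Fin n → Fin 3 → ℕ) (P : TP 3) (v : V) : Prop :=
  ∃ (c : Fin n → ℝ) (p : Fin 3 → ℝ), TP.mk c = L.pos v ∧ TP.mk p = P ∧
    ∃ i j k, L.Separates v i j ∧ L.Separates v i k ∧ L.Separates v j k ∧
      i ∈ minTerms a c p ∧ j ∈ minTerms a c p ∧ k ∈ minTerms a c p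

end

/-! At a vertex `v` of the line, the three edges split the leaves into three classes and so color
the points `a i` with three colors. Compatibility restricts how a segment inside one color can meet
a segment joining points of other colors. The Sperner-type lemma
`ColoringCompatible.exists_trichromatic` then finds a triangle of the triangulation `Δ(v)` with one
vertex of each color; the point dual to this triangle is the member of `C` attached to `v`.

The lemma is proved dually. Let `f m` be the minimum of the terms of color `m`, as a function of the
functional `p`; a point with `f 0 = f 1 = f 2` is wanted. Any two colors are joined by an edge of
the triangulation (`ColoringCompatible.exists_bicolored_cell`), so two of the minima agree somewhere
without exceeding the third. If two classes have disjoint hulls, the difference of their minima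
grows uniformly in a separating direction, so the locus where they agree and the region where one
dominates are connected (`isPreconnected_of_increasing`). Compatibility makes the hulls pairwise
disjoint unless one of them contains all points of the other colors; in both cases the intermediate
value theorem concludes.

With the points chosen, the rest is combinatorics of the tree. Moving along `L` away from `u` raises
only coefficients in one branch at `u`, so two of the three minimal terms at the point of `u`
survive, and all of `L` passes through `C`. Conversely, let `c` pass through `C` and let `M` be the
set of leaves where `c - v` is minimal. The points beyond an edge force `M` to contain all leaves
beyond it or none (`OnAll.minDiff_beyond`), and the point of `v` forces `M` to contain two of the
three branches (`OnAll.minDiff_vertex`). So either `c` is `v`, or `c` lies in the direction of the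
remaining branch and is followed along the tree. Generality follows from the same description of
`M`, and a trivalent tree with `n` leaves has `n - 2` vertices. -/

namespace TropicalPencil

open Set Filter Topology

set_option linter.unusedSectionVars false

/-! ### Convex combinations and cells of regular subdivisions -/

section Hull

variable {ι E : Type*} [Fintype ι] [NormedAddCommGroup E] [NormedSpace ℝ E]

/-- Points of the hull of a subfamily are the convex combinations with weights supported on it. -/
theorem mem_convexHull_image_iff {b : ι → E} {S : Set ι} {x : E} :
    x ∈ convexHull ℝ (b '' S) ↔ ∃ w : ι → ℝ, (∀ i, 0 ≤ w i) ∧ (∀ i, i ∉ S → w i = 0) ∧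
      ∑ i, w i = 1 ∧ ∑ i, w i • b i = x := by
  classical
  constructor
  · intro hx
    refine convexHull_min (t := {x | ∃ w : ι → ℝ, (∀ i, 0 ≤ w i) ∧ (∀ i, i ∉ S → w i = 0) ∧
      ∑ i, w i = 1 ∧ ∑ i, w i • b i = x}) ?_ ?_ hx
    · rintro _ ⟨i, hi, rfl⟩
      refine ⟨Pi.single i 1, fun j => ?_, fun j hj => ?_, by simp, ?_⟩
      · by_cases h : j = i
        · subst h; simp
        · simp [h]
      · rw [Pi.single_eq_of_ne]
        rintro rfl
        exact hj hi
      · simp [Pi.single_apply]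
    · rintro _ ⟨w, hw0, hwS, hw1, rfl⟩ _ ⟨v, hv0, hvS, hv1, rfl⟩ s t hs ht hst
      refine ⟨fun i => s * w i + t * v i, fun i => ?_, fun i hi => ?_, ?_, ?_⟩
      · have := hw0 i
        have := hv0 i
        positivity
      · simp [hwS i hi, hvS i hi]
      · rw [Finset.sum_add_distrib, ← Finset.mul_sum, ← Finset.mul_sum, hw1, hv1]
        linarith
      · simp only [add_smul, mul_smul, Finset.sum_add_distrib, Finset.smul_sum]
  · rintro ⟨w, hw0, hwS, hw1, rfl⟩
    rw [← Finset.sum_filter_add_sum_filter_not Finset.univ (fun i => i ∈ S)] at hw1 ⊢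
    have h1 : ∑ i with i ∉ S, w i = 0 :=
      Finset.sum_eq_zero fun i hi => hwS i (Finset.mem_filter.1 hi).2
    have h2 : ∑ i with i ∉ S, w i • b i = 0 :=
      Finset.sum_eq_zero fun i hi => by rw [hwS i (Finset.mem_filter.1 hi).2, zero_smul]
    rw [h2, add_zero]
    rw [h1, add_zero] at hw1
    exact (convex_convexHull ℝ _).sum_mem (fun i _ => hw0 i) hw1
      fun i hi => subset_convexHull ℝ _ ⟨i, (Finset.mem_filter.1 hi).2, rfl⟩

theorem segment_subset_convexHull_image {b : ι → E} {S : Set ι} {i j : ι} (hi : i ∈ S)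
    (hj : j ∈ S) : segment ℝ (b i) (b j) ⊆ convexHull ℝ (b '' S) :=
  (convex_convexHull ℝ _).segment_subset (subset_convexHull ℝ _ (mem_image_of_mem b hi))
    (subset_convexHull ℝ _ (mem_image_of_mem b hj))

theorem isCompact_convexHull_image (b : ι → E) (S : Set ι) :
    IsCompact (convexHull ℝ (b '' S)) :=
  (S.toFinite.image b).isCompact_convexHull ℝ

/-- The indices at which the affine terms `c i + p (b i)` are minimal. -/
def cell (b : ι → E) (c : ι → ℝ) (p : StrongDual ℝ E) : Set ι :=
  {i | ∀ l, c i + p (b i) ≤ c l + p (b l)}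

theorem cell_nonempty [Nonempty ι] (b : ι → E) (c : ι → ℝ) (p : StrongDual ℝ E) :
    (cell b c p).Nonempty := by
  obtain ⟨i, hi⟩ := Finite.exists_min fun l => c l + p (b l)
  exact ⟨i, hi⟩

theorem cell_eq {b : ι → E} {c : ι → ℝ} {p : StrongDual ℝ E} {i j : ι}
    (hi : i ∈ cell b c p) (hj : j ∈ cell b c p) : c i + p (b i) = c j + p (b j) :=
  le_antisymm (hi j) (hj i)

theorem mem_cell_of_le {b : ι → E} {c : ι → ℝ} {p : StrongDual ℝ E} {i j : ι}
    (hi : i ∈ cell b c p) (hj : c j + p (b j) ≤ c i + p (b i)) : j ∈ cell b c p :=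
  fun l => hj.trans (hi l)

theorem lt_of_notMem_cell {b : ι → E} {c : ι → ℝ} {p : StrongDual ℝ E} {i j : ι}
    (hi : i ∈ cell b c p) (hj : j ∉ cell b c p) : c i + p (b i) < c j + p (b j) := by
  by_contra h
  exact hj (mem_cell_of_le hi (not_lt.1 h))

theorem weighted_apply {b : ι → E} {c w : ι → ℝ} (p : StrongDual ℝ E) :
    ∑ i, w i * (c i + p (b i)) = ∑ i, w i * c i + p (∑ i, w i • b i) := by
  simp [mul_add, Finset.sum_add_distrib, map_sum]

/-- Weights supported on a cell average the terms to their minimum. -/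
theorem weighted_cell {b : ι → E} {c w : ι → ℝ} {p : StrongDual ℝ E} {i : ι}
    (hi : i ∈ cell b c p) (hS : ∀ j, j ∉ cell b c p → w j = 0) :
    ∑ j, w j * (c j + p (b j)) = (∑ j, w j) * (c i + p (b i)) := by
  rw [Finset.sum_mul]
  refine Finset.sum_congr rfl fun j _ => ?_
  by_cases hj : j ∈ cell b c p
  · rw [cell_eq hi hj]
  · simp [hS j hj]

theorem le_weighted {b : ι → E} {c w : ι → ℝ} {p : StrongDual ℝ E} {i : ι}
    (hi : i ∈ cell b c p) (h0 : ∀ j, 0 ≤ w j) :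
    (∑ j, w j) * (c i + p (b i)) ≤ ∑ j, w j * (c j + p (b j)) := by
  rw [Finset.sum_mul]
  exact Finset.sum_le_sum fun j _ => mul_le_mul_of_nonneg_left (hi j) (h0 j)

/-- Nonnegative weights averaging the terms to their minimum are supported on the cell. -/
theorem support_subset_cell {b : ι → E} {c w : ι → ℝ} {p : StrongDual ℝ E} {i : ι}
    (hi : i ∈ cell b c p) (h0 : ∀ j, 0 ≤ w j)
    (h : ∑ j, w j * (c j + p (b j)) ≤ (∑ j, w j) * (c i + p (b i))) {j : ι} (hj : w j ≠ 0) :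
    j ∈ cell b c p := by
  by_contra hjc
  refine absurd h (not_le.2 ?_)
  rw [Finset.sum_mul]
  exact Finset.sum_lt_sum (fun k _ => mul_le_mul_of_nonneg_left (hi k) (h0 k))
    ⟨j, Finset.mem_univ j, mul_lt_mul_of_pos_left (lt_of_notMem_cell hi hjc)
      (lt_of_le_of_ne (h0 j) (Ne.symm hj))⟩

/-- Two convex representations of a point in cells of the same subdivision are both supported on
the intersection of the cells. -/
theorem support_subset_of_two_cells [Nonempty ι] {b : ι → E} {c v w : ι → ℝ}
    {p q : StrongDual ℝ E}
    (hv0 : ∀ i, 0 ≤ v i) (hvS : ∀ i, i ∉ cell b c p → v i = 0) (hv1 : ∑ i, v i = 1)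
    (hw0 : ∀ i, 0 ≤ w i) (hwS : ∀ i, i ∉ cell b c q → w i = 0) (hw1 : ∑ i, w i = 1)
    (h : ∑ i, v i • b i = ∑ i, w i • b i) {i : ι} (hi : v i ≠ 0) : i ∈ cell b c q := by
  obtain ⟨k, hk⟩ := cell_nonempty b c p
  obtain ⟨l, hl⟩ := cell_nonempty b c q
  have e1 := weighted_cell hk hvS
  have e2 := weighted_cell hl hwS
  have e3 := le_weighted hk hw0
  rw [hv1] at e1
  rw [hw1] at e2 e3
  rw [weighted_apply] at e1 e2 e3
  -- Comparison at `p` gives `∑ v c ≤ ∑ w c` over the common point, so `v` too averages the terms at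
  -- `q` to their minimum.
  refine support_subset_cell hl hv0 ?_ hi
  rw [weighted_apply, hv1, h]
  rw [h] at e1
  linarith

/-- The minimum of the terms with index in `S`. -/
noncomputable def lowTerm (b : ι → E) (c : ι → ℝ) (S : Finset ι) (hS : S.Nonempty)
    (p : StrongDual ℝ E) : ℝ := S.inf' hS fun i => c i + p (b i)

theorem continuous_lowTerm (b : ι → E) (c : ι → ℝ) (S : Finset ι) (hS : S.Nonempty) :
    Continuous (lowTerm b c S hS) := by
  unfold lowTerm
  refine Continuous.finset_inf'_apply hS fun i _ => ?_
  fun_prop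

end Hull

/-! ### The cells cover the hull -/

section Existence

variable {ι E : Type*} [Fintype ι] [Nonempty ι] [NormedAddCommGroup E] [NormedSpace ℝ E]
  [FiniteDimensional ℝ E]

/-- Coercivity: if `x` is interior to the hull of the family, the minimum of the terms drops at
least linearly below `p x`. -/
theorem exists_lowTerm_le {b : ι → E} (c : ι → ℝ) {S : Finset ι} (hS : S.Nonempty) {x : E}
    (hx : x ∈ interior (convexHull ℝ (b '' S))) :
    ∃ r > 0, ∃ C, ∀ p : StrongDual ℝ E, lowTerm b c S hS p ≤ p x + C - r * ‖p‖ := by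
  obtain ⟨ρ, hρ, hball⟩ := Metric.isOpen_iff.1 isOpen_interior x hx
  obtain ⟨m, hm⟩ := Finite.exists_max c
  -- The rate is the step `ρ / 2` that stays in the ball, times the factor `1 / 2` lost by an almost
  -- norming vector `z`.
  refine ⟨ρ / 4, by positivity, c m, fun p => ?_⟩
  -- a point `z` of the unit ball with `‖p‖ / 2 ≤ p z`
  obtain ⟨z, hz, hpz⟩ : ∃ z : E, ‖z‖ ≤ 1 ∧ ‖p‖ / 2 ≤ p z := by
    by_contra! hcon
    have h1 : ‖p‖ ≤ ‖p‖ / 2 := by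
      refine ContinuousLinearMap.opNorm_le_of_ball (ε := 1) one_pos (by positivity) fun y hy => ?_
      rcases eq_or_ne y 0 with rfl | hy0
      · simp
      have hyn : 0 < ‖y‖ := norm_pos_iff.2 hy0
      have k1 := hcon (‖y‖⁻¹ • y) (by rw [norm_smul, norm_inv, norm_norm, inv_mul_cancel₀ hyn.ne'])
      have k2 := hcon (-(‖y‖⁻¹ • y))
        (by rw [norm_neg, norm_smul, norm_inv, norm_norm, inv_mul_cancel₀ hyn.ne'])
      rw [map_neg, map_smul, smul_eq_mul] at k2
      rw [map_smul, smul_eq_mul] at k1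
      have e : p y = ‖y‖ * (‖y‖⁻¹ * p y) := by field_simp
      rw [Real.norm_eq_abs, abs_le, e]
      constructor <;> nlinarith
    have h2 : ‖p‖ = 0 := by linarith [norm_nonneg p]
    have := hcon 0 (by simp)
    simp [h2] at this
  have hy : x - (ρ / 2) • z ∈ convexHull ℝ (b '' S) := by
    apply interior_subset
    apply hball
    rw [Metric.mem_ball, dist_eq_norm, sub_sub_cancel_left, norm_neg, norm_smul, Real.norm_eq_abs,
      abs_of_pos (by positivity)]
    nlinarith
  obtain ⟨w, hw0, hwS, hw1, hwx⟩ := mem_convexHull_image_iff.1 hy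
  have h1 : ∑ i, w i * lowTerm b c S hS p ≤ ∑ i, w i * (c m + p (b i)) := by
    refine Finset.sum_le_sum fun i _ => ?_
    by_cases hi : i ∈ S
    · refine mul_le_mul_of_nonneg_left ?_ (hw0 i)
      exact (Finset.inf'_le _ hi).trans (by linarith [hm i])
    · simp [hwS i (by simpa using hi)]
  rw [← Finset.sum_mul, hw1, weighted_apply (c := fun _ => c m), hwx, ← Finset.sum_mul, hw1,
    map_sub, map_smul, smul_eq_mul] at h1
  nlinarith

/-- By coercivity `p x - lowTerm p` has a minimizer. If `x` were outside the hull of the cell there,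
a separating direction would raise every active term faster than `p x`, contradicting minimality. -/
theorem exists_mem_cell_of_mem_interior {b : ι → E} (c : ι → ℝ) {x : E}
    (hx : x ∈ interior (convexHull ℝ (range b))) :
    ∃ p, x ∈ convexHull ℝ (b '' cell b c p) := by
  obtain ⟨r, hr, C, hC⟩ := exists_lowTerm_le (b := b) c (S := Finset.univ) Finset.univ_nonempty
    (x := x) (by simpa using hx)
  set G : StrongDual ℝ E → ℝ := fun p => p x - lowTerm b c Finset.univ Finset.univ_nonempty p
  have hGc : Continuous G := by
    have := continuous_lowTerm b c Finset.univ Finset.univ_nonempty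
    fun_prop
  have hG : Tendsto G (cocompact _) atTop := by
    have h1 : Tendsto (fun p : StrongDual ℝ E => r * ‖p‖ - C) (cocompact _) atTop :=
      tendsto_atTop_add_const_right _ _ ((tendsto_norm_cocompact_atTop).const_mul_atTop hr)
    refine tendsto_atTop_mono (fun p => ?_) h1
    have := hC p
    simp only [G]
    linarith
  obtain ⟨p, hp⟩ := hGc.exists_forall_le hG
  refine ⟨p, ?_⟩
  by_contra hxn
  obtain ⟨q, u, hq1, hq2⟩ := geometric_hahn_banach_point_closed (convex_convexHull ℝ _)
    (isCompact_convexHull_image b (cell b c p)).isClosed hxn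
  -- moving in the direction `q` increases the minimum
  obtain ⟨k, hk⟩ := cell_nonempty b c p
  have hev : ∀ l, ∀ᶠ ε in 𝓝[>] (0 : ℝ), c k + p (b k) + ε * q x < c l + p (b l) + ε * q (b l) := by
    intro l
    by_cases hl : l ∈ cell b c p
    · filter_upwards [self_mem_nhdsWithin] with ε hε
      have h1 := hq2 _ (subset_convexHull ℝ _ (mem_image_of_mem b hl))
      have h2 := cell_eq hk hl
      have : (0 : ℝ) < ε := hε
      nlinarith
    · have h1 := lt_of_notMem_cell hk hl
      have h2 : Tendsto (fun ε : ℝ => c l + p (b l) + ε * q (b l) - (c k + p (b k) + ε * q x))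
          (𝓝[>] 0) (𝓝 (c l + p (b l) + 0 * q (b l) - (c k + p (b k) + 0 * q x))) := by
        refine Tendsto.mono_left ?_ nhdsWithin_le_nhds
        exact Continuous.tendsto (by fun_prop) 0
      filter_upwards [h2.eventually_const_lt (u := 0) (by linarith)] with ε hε
      linarith
  obtain ⟨ε, hε⟩ := (eventually_all.2 hev).exists
  have h1 := hp (p + ε • q)
  simp only [G] at h1
  have h2 : lowTerm b c Finset.univ Finset.univ_nonempty p ≤ c k + p (b k) :=
    Finset.inf'_le _ (Finset.mem_univ k)
  have h3 : c k + p (b k) + ε * q x <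
      lowTerm b c Finset.univ Finset.univ_nonempty (p + ε • q) := by
    rw [lowTerm, Finset.lt_inf'_iff]
    intro l _
    have := hε l
    simp only [_root_.add_apply, _root_.smul_apply, smul_eq_mul]
    linarith
  simp only [_root_.add_apply, _root_.smul_apply, smul_eq_mul] at h1
  linarith

/-- The cells of a regular subdivision cover the hull. -/
theorem exists_mem_cell {b : ι → E} (hb : affineSpan ℝ (range b) = ⊤) (c : ι → ℝ) {x : E}
    (hx : x ∈ convexHull ℝ (range b)) : ∃ p, x ∈ convexHull ℝ (b '' cell b c p) := by
  -- Boundary points are limits of interior ones, and a finite union of closed cells is closed.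
  have hfin : (range fun p : StrongDual ℝ E => cell b c p).Finite := Set.toFinite _
  have hcl : IsClosed (⋃ M ∈ range fun p : StrongDual ℝ E => cell b c p,
      convexHull ℝ (b '' M)) :=
    hfin.isClosed_biUnion fun M _ => (isCompact_convexHull_image b M).isClosed
  have hint : interior (convexHull ℝ (range b)) ⊆
      ⋃ M ∈ range fun p : StrongDual ℝ E => cell b c p, convexHull ℝ (b '' M) := by
    intro y hy
    obtain ⟨p, hp⟩ := exists_mem_cell_of_mem_interior c hy
    exact mem_biUnion (mem_range_self p) hp
  have h1 := closure_minimal hint hcl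
  rw [(convex_convexHull ℝ _).closure_interior_eq_closure_of_nonempty_interior
    (interior_convexHull_nonempty_iff_affineSpan_eq_top.2 hb)] at h1
  obtain ⟨_, ⟨p, rfl⟩, hp⟩ := mem_iUnion₂.1 (h1 (subset_closure hx))
  exact ⟨p, hp⟩

end Existence

/-! ### Maximal subdivisions are triangulations using every point -/

section Maximal

variable {ι E : Type*} [Fintype ι] [NormedAddCommGroup E] [NormedSpace ℝ E]
  [FiniteDimensional ℝ E]

/-- A subdivision which is not properly refined by any other one. -/
def MaximalHeights (b : ι → E) (c : ι → ℝ) : Prop :=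
  ∀ c' : ι → ℝ, (∀ p', ∃ p, convexHull ℝ (b '' cell b c' p') ⊆ convexHull ℝ (b '' cell b c p)) →
    ∀ p, ∃ p', convexHull ℝ (b '' cell b c' p') = convexHull ℝ (b '' cell b c p)

theorem exists_weights {N : Set ι} [Fintype N] (hN : N.Nonempty) :
    ∃ w : ι → ℝ, (∀ i, 0 ≤ w i) ∧ (∀ i, i ∉ N → w i = 0) ∧ (∀ i ∈ N, w i ≠ 0) ∧
      ∑ i, w i = 1 := by
  classical
  have hpos : 0 < (N.toFinset.card : ℝ) := by
    exact_mod_cast Finset.card_pos.2 (Set.toFinset_nonempty.2 hN)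
  refine ⟨fun i => if i ∈ N then (N.toFinset.card : ℝ)⁻¹ else 0, fun i => ?_, fun i hi => ?_,
    fun i hi => ?_, ?_⟩
  · dsimp only; split_ifs <;> positivity
  · simp [hi]
  · simp only [hi, if_true]; positivity
  · rw [← Finset.sum_filter, Finset.sum_const, nsmul_eq_mul]
    have : Finset.univ.filter (· ∈ N) = N.toFinset := by ext; simp
    rw [this, mul_inv_cancel₀ hpos.ne']

/-- A small perturbation of the heights refines the subdivision. -/
theorem exists_refining_perturbation [Nonempty ι] {b : ι → E} (hb : affineSpan ℝ (range b) = ⊤)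
    (c u : ι → ℝ) : ∃ ε > 0, ∀ p', ∃ p, cell b (fun i => c i + ε * u i) p' ⊆ cell b c p := by
  classical
  -- If `N` lies in no old cell, its barycenter is reached strictly lower by weights `v` on some old
  -- cell. The gap survives small `ε`, so `N` is not a cell of the perturbed heights; there are
  -- finitely many `N`.
  have key : ∀ N : Set ι, ∀ᶠ ε in 𝓝[>] (0 : ℝ), ∀ p',
      cell b (fun i => c i + ε * u i) p' = N → ∃ p, N ⊆ cell b c p := by
    intro N
    rcases N.eq_empty_or_nonempty with rfl | hN
    · exact Eventually.of_forall fun ε p' h => ⟨0, empty_subset _⟩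
    by_cases hgood : ∃ p, N ⊆ cell b c p
    · exact Eventually.of_forall fun ε p' h => hgood
    obtain ⟨w, hw0, hwN, hwN', hw1⟩ := exists_weights hN
    have hx : ∑ i, w i • b i ∈ convexHull ℝ (range b) := by
      rw [← image_univ]
      exact mem_convexHull_image_iff.2 ⟨w, hw0, by simp, hw1, rfl⟩
    obtain ⟨p, hp⟩ := exists_mem_cell hb c hx
    obtain ⟨v, hv0, hvS, hv1, hvx⟩ := mem_convexHull_image_iff.1 hp
    obtain ⟨k, hk⟩ := cell_nonempty b c p
    have hgap : ∑ i, v i * c i < ∑ i, w i * c i := by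
      by_contra hle
      apply hgood
      refine ⟨p, fun i hi => support_subset_cell hk hw0 ?_ (hwN' i hi)⟩
      have := weighted_cell hk hvS
      rw [weighted_apply, hvx, hv1] at this
      rw [weighted_apply, hw1]
      linarith
    have htend : Tendsto (fun ε : ℝ => (∑ i, w i * (c i + ε * u i)) - ∑ i, v i * (c i + ε * u i))
        (𝓝[>] 0) (𝓝 ((∑ i, w i * (c i + 0 * u i)) - ∑ i, v i * (c i + 0 * u i))) :=
      (Continuous.tendsto (by fun_prop) 0).mono_left nhdsWithin_le_nhds
    filter_upwards [htend.eventually_const_lt (u := 0) (by simpa using hgap)] with ε hε p' hp'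
    exfalso
    obtain ⟨l, hl⟩ := hN
    rw [← hp'] at hl hwN
    have e1 := weighted_cell hl hwN
    have e2 := le_weighted hl hv0
    rw [weighted_apply, hw1] at e1
    rw [weighted_apply, hv1, hvx] at e2
    linarith
  obtain ⟨ε, hε, hpos⟩ := ((eventually_all.2 key).and self_mem_nhdsWithin).exists
  exact ⟨ε, hpos, fun p' => hε _ p' rfl⟩

theorem convexHull_image_extremePoints {b : ι → E} (M : Set ι) :
    convexHull ℝ ((convexHull ℝ (b '' M)).extremePoints ℝ) = convexHull ℝ (b '' M) := by
  have h := closure_convexHull_extremePoints (isCompact_convexHull_image b M)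
    (convex_convexHull ℝ _)
  rwa [(((M.toFinite.image b).subset extremePoints_convexHull_subset).isCompact_convexHull
    ℝ).isClosed.closure_eq] at h

/-- In a maximal subdivision, the cells are simplices. -/
theorem MaximalHeights.eq_zero_of_relation [Nonempty ι] {b : ι → E} {c : ι → ℝ}
    (hmax : MaximalHeights b c)
    (hinj : Function.Injective b) (hb : affineSpan ℝ (range b) = ⊤) {p : StrongDual ℝ E}
    {r : ι → ℝ} (hr : ∀ i, i ∉ cell b c p → r i = 0) (hr0 : ∑ i, r i = 0)
    (hrb : ∑ i, r i • b i = 0) : r = 0 := by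
  classical
  set K := convexHull ℝ (b '' cell b c p) with hK
  set X := K.extremePoints ℝ with hX
  -- pushing down the height at one point of the cell
  have push : ∀ m, ∃ ε > 0, ∃ p', convexHull ℝ (b '' cell b (fun i => c i + ε *
      (-Pi.single m (1 : ℝ) : ι → ℝ) i) p') = K := by
    intro m
    obtain ⟨ε, hε, h⟩ := exists_refining_perturbation hb c (-Pi.single m (1 : ℝ))
    refine ⟨ε, hε, hmax _ (fun p' => ?_) p⟩
    obtain ⟨q, hq⟩ := h p'
    exact ⟨q, convexHull_mono (image_mono hq)⟩
  have hXsub : ∀ {M : Set ι}, convexHull ℝ (b '' M) = K → ∀ i, b i ∈ X → i ∈ M := by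
    intro M hM i hi
    rw [hX, ← hM] at hi
    obtain ⟨j, hj, hji⟩ := extremePoints_convexHull_subset hi
    exact hinj hji ▸ hj
  -- every point of the cell is a vertex of its hull
  have hvert : ∀ m ∈ cell b c p, b m ∈ X := by
    intro m hm
    by_contra hmX
    obtain ⟨ε, hε, p', hp'⟩ := push m
    set c' : ι → ℝ := fun i => c i + ε * (-Pi.single m (1 : ℝ) : ι → ℝ) i with hc'
    have hmK : b m ∈ convexHull ℝ (b '' {i | b i ∈ X}) := by
      have : b '' {i | b i ∈ X} = X := by
        ext y
        constructor
        · rintro ⟨i, hi, rfl⟩; exact hi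
        · intro hy
          obtain ⟨j, hj, rfl⟩ := extremePoints_convexHull_subset hy
          exact ⟨j, hy, rfl⟩
      rw [this, hX, hK, convexHull_image_extremePoints]
      exact subset_convexHull ℝ _ ⟨m, hm, rfl⟩
    obtain ⟨w, hw0, hwS, hw1, hwx⟩ := mem_convexHull_image_iff.1 hmK
    have hwm : w m = 0 := hwS m hmX
    obtain ⟨k, hk⟩ := cell_nonempty b c' p'
    -- Both cells contain all extreme points, so `w` averages the terms to the minimum for either
    -- heights. The heights differ only at `m`, where `w` vanishes, so lowering `m` would drop its
    -- term below the minimum.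
    have e1 := weighted_cell (w := w) hk fun j hj => hwS j fun hjX => hj (hXsub hp' j hjX)
    have e2 := weighted_cell (w := w) hm fun j hj => hwS j fun hjX => hj (hXsub rfl j hjX)
    have e3 : ∑ i, w i * c' i = ∑ i, w i * c i := by
      refine Finset.sum_congr rfl fun i _ => ?_
      by_cases him : i = m
      · subst him; simp [hwm]
      · simp [hc', him]
    rw [weighted_apply, hw1, hwx] at e1 e2
    have e4 := hk m
    have e5 : c' m = c m - ε := by simp [hc']; ring
    linarith
  funext m
  by_contra hm0
  have hm : m ∈ cell b c p := by
    by_contra h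
    exact hm0 (hr m h)
  -- All points of the cell are extreme, so all survive in the perturbed cell. The relation then
  -- annihilates the heights before and after lowering `m`, whence `ε * r m = 0`.
  obtain ⟨ε, hε, p', hp'⟩ := push m
  set c' : ι → ℝ := fun i => c i + ε * (-Pi.single m (1 : ℝ) : ι → ℝ) i with hc'
  obtain ⟨k, hk⟩ := cell_nonempty b c' p'
  have e1 := weighted_cell (w := r) hk fun j hj => hr j fun hjc => hj (hXsub hp' j (hvert j hjc))
  have e2 := weighted_cell (w := r) hm hr
  have e3 : ∑ i, r i * c' i = ∑ i, r i * c i - ε * r m := by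
    simp [hc', mul_add, Finset.sum_add_distrib, Pi.single_apply]
    ring
  rw [weighted_apply, hr0, hrb] at e1 e2
  have : ε * r m = 0 := by simp only [map_zero] at e1 e2; linarith
  rcases mul_eq_zero.1 this with h | h
  · exact hε.ne' h
  · exact hm0 h

/-- In a maximal subdivision, every point of the support is a vertex. -/
theorem MaximalHeights.exists_mem_cell [Nonempty ι] {b : ι → E} {c : ι → ℝ}
    (hmax : MaximalHeights b c)
    (hinj : Function.Injective b) (hb : affineSpan ℝ (range b) = ⊤) (l : ι) :
    ∃ p, l ∈ cell b c p := by
  classical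
  by_contra! hl
  obtain ⟨p₀, hp₀⟩ := TropicalPencil.exists_mem_cell hb c
    (subset_convexHull ℝ _ (mem_range_self l))
  obtain ⟨w, hw0, hwS, hw1, hwx⟩ := mem_convexHull_image_iff.1 hp₀
  have hwl : w l = 0 := hwS l (hl p₀)
  -- The point `l` sits strictly above the lower hull. Lowering it onto the hull changes no hull of
  -- a cell, hence keeps maximality, but creates an affine relation inside a cell.
  set c₁ := Function.update c l (∑ i, w i * c i) with hc₁
  have hne : ∀ i, i ≠ l → c₁ i = c i := fun i hi => Function.update_of_ne hi _ _
  have hterm : ∀ p : StrongDual ℝ E, c₁ l + p (b l) = ∑ i, w i * (c i + p (b i)) := by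
    intro p
    rw [weighted_apply, hwx, hc₁, Function.update_self]
  have hmin : ∀ p, ∀ k ∈ cell b c p, k ∈ cell b c₁ p := by
    intro p k hk i
    have hkl : k ≠ l := by rintro rfl; exact hl p hk
    rw [hne k hkl]
    by_cases hi : i = l
    · subst hi
      rw [hterm]
      have := le_weighted hk hw0
      rwa [hw1, one_mul] at this
    · rw [hne i hi]; exact hk i
  have hmin' : ∀ p, ∀ k ∈ cell b c₁ p, k ≠ l → k ∈ cell b c p := by
    intro p k hk hkl
    obtain ⟨j, hj⟩ := cell_nonempty b c p
    have hjl : j ≠ l := by rintro rfl; exact hl p hj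
    refine mem_cell_of_le hj ?_
    have := hk j
    rwa [hne j hjl, hne k hkl] at this
  have hull : ∀ p, convexHull ℝ (b '' cell b c₁ p) = convexHull ℝ (b '' cell b c p) := by
    intro p
    refine subset_antisymm (convexHull_min ?_ (convex_convexHull ℝ _))
      (convexHull_mono (image_mono (hmin p)))
    rintro _ ⟨k, hk, rfl⟩
    by_cases hkl : k = l
    · subst hkl
      obtain ⟨j, hj⟩ := cell_nonempty b c p
      have hjl : j ≠ k := by rintro rfl; exact hl p hj
      refine mem_convexHull_image_iff.2 ⟨w, hw0, fun i hi => ?_, hw1, hwx⟩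
      by_contra hwi
      refine hi (support_subset_cell hj hw0 ?_ hwi)
      have := hk j
      rw [hne j hjl, hterm] at this
      rwa [hw1, one_mul]
    · exact subset_convexHull ℝ _ ⟨k, hmin' p k hk hkl, rfl⟩
  have hmax₁ : MaximalHeights b c₁ := by
    intro c' h p
    simp only [hull] at h ⊢
    exact hmax c' h p
  have hl₁ : l ∈ cell b c₁ p₀ := by
    obtain ⟨j, hj⟩ := cell_nonempty b c p₀
    have hjl : j ≠ l := by rintro rfl; exact hl p₀ hj
    refine mem_cell_of_le (hmin p₀ j hj) ?_
    rw [hterm, weighted_cell hj hwS, hw1, one_mul, hne j hjl]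
  have := hmax₁.eq_zero_of_relation hinj hb (p := p₀) (r := w - Pi.single l 1)
    (fun i hi => ?_) (by simp [hw1]) (by simp [sub_smul, hwx, Pi.single_apply])
  · have := congrFun this l
    simp [hwl] at this
  · have hil : i ≠ l := by rintro rfl; exact hi hl₁
    have : w i = 0 := hwS i fun h => hi (hmin p₀ i h)
    simp [this, hil]

/-- The hull of a cell contains no further point of the support. -/
theorem MaximalHeights.mem_cell_of_mem_hull [Nonempty ι] {b : ι → E} {c : ι → ℝ}
    (hmax : MaximalHeights b c)
    (hinj : Function.Injective b) (hb : affineSpan ℝ (range b) = ⊤) {l : ι}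
    {p : StrongDual ℝ E} (h : b l ∈ convexHull ℝ (b '' cell b c p)) : l ∈ cell b c p := by
  classical
  obtain ⟨q, hq⟩ := hmax.exists_mem_cell hinj hb l
  obtain ⟨w, hw0, hwS, hw1, hwx⟩ := mem_convexHull_image_iff.1 h
  refine support_subset_of_two_cells (b := b) (c := c) (p := q) (q := p) (v := Pi.single l 1)
    (w := w) (fun i => ?_) (fun i hi => ?_) (by simp) hw0 hwS hw1 ?_ (i := l) (by simp)
  · by_cases h : i = l
    · subst h; simp
    · simp [h]
  · have : i ≠ l := by rintro rfl; exact hi hq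
    simp [this]
  · simp [Pi.single_apply, hwx]

/-- The cells of a maximal subdivision of a polygon have at most three vertices. -/
theorem MaximalHeights.card_le [Nonempty ι] {b : ι → E} {c : ι → ℝ}
    (hmax : MaximalHeights b c)
    (hinj : Function.Injective b) (hb : affineSpan ℝ (range b) = ⊤)
    (hE : Module.finrank ℝ E = 2) (p : StrongDual ℝ E) (S : Finset ι) (hS : ↑S ⊆ cell b c p) :
    S.card ≤ 3 := by
  classical
  by_contra! hlt
  obtain ⟨f, hf1, hf2, x, hx, hfx⟩ :=
    Module.exists_nontrivial_relation_sum_zero_of_finrank_succ_lt_card (R := ℝ)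
    (t := S.image b) (by rw [hE, Finset.card_image_of_injective _ hinj]; omega)
  have := hmax.eq_zero_of_relation hinj hb (p := p) (r := fun i => if i ∈ S then f (b i) else 0)
    (fun i hi => by
      have : i ∉ S := fun h => hi (hS h)
      simp [this]) ?_ ?_
  · obtain ⟨i, hi, rfl⟩ := Finset.mem_image.1 hx
    have := congrFun this i
    simp only [hi, if_true, Pi.zero_apply] at this
    exact hfx this
  · rw [Finset.sum_image fun i _ j _ h => hinj h] at hf2
    simpa using hf2
  · rw [Finset.sum_image fun i _ j _ h => hinj h] at hf1
    simpa [ite_smul] using hf1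

end Maximal

/-! ### Segments and hull edges in the plane -/

section Plane

variable {ι E : Type*} [Fintype ι] [NormedAddCommGroup E] [NormedSpace ℝ E]
  [FiniteDimensional ℝ E]

/-- In the plane, a point of the hull which is not interior lies on a segment. -/
theorem exists_segment_of_notMem_interior (hE : Module.finrank ℝ E = 2) {b : ι → E} {S : Set ι}
    {z : E} (hz : z ∈ convexHull ℝ (b '' S)) (hz' : z ∉ interior (convexHull ℝ (b '' S))) :
    ∃ i ∈ S, ∃ i' ∈ S, z ∈ segment ℝ (b i) (b i') := by
  classical
  -- Carathéodory with positive weights: three affinely independent points would make `z` interior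
  -- to their triangle, so at most two occur.
  obtain ⟨κ, _, y, w, hy, hind, hw0, hw1, hwz⟩ := eq_pos_convex_span_of_mem_convexHull hz
  have hzy : z ∈ convexHull ℝ (range y) := by
    rw [← hwz]
    exact (convex_convexHull ℝ _).sum_mem (fun i _ => (hw0 i).le) hw1
      fun i _ => subset_convexHull ℝ _ (mem_range_self i)
  have hcard : Fintype.card κ ≤ 3 := by
    have h1 := hind.card_le_finrank_succ
    have h2 := Submodule.finrank_le (vectorSpan ℝ (range y))
    omega
  have hne : Fintype.card κ ≠ 3 := by
    intro h3
    have htop : affineSpan ℝ (range y) = ⊤ :=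
      hind.affineSpan_eq_top_iff_card_eq_finrank_add_one.2 (by omega)
    let B : AffineBasis κ ℝ E := ⟨y, hind, htop⟩
    apply hz'
    refine interior_mono (convexHull_mono hy) ?_
    have := B.interior_convexHull
    change z ∈ interior (convexHull ℝ (range B))
    rw [this]
    intro i
    have h4 : Finset.univ.affineCombination ℝ y w = z := by
      rw [Finset.affineCombination_eq_linear_combination _ _ _ hw1, hwz]
    have := B.coord_apply_combination_of_mem (Finset.mem_univ i) hw1
    change B.coord i (Finset.univ.affineCombination ℝ y w) = w i at this
    rw [h4] at this
    rw [this]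
    exact hw0 i
  obtain ⟨a, a', ha⟩ : ∃ a a' : κ, ∀ x, x = a ∨ x = a' := by
    have hpos : Fintype.card κ ≠ 0 := by
      intro h
      rw [Fintype.card_eq_zero_iff] at h
      simp at hw1
    have h12 : Fintype.card κ = 1 ∨ Fintype.card κ = 2 := by omega
    rcases h12 with h | h
    · obtain ⟨a, ha⟩ := Fintype.card_eq_one_iff.1 h
      exact ⟨a, a, fun x => Or.inl (ha x)⟩
    · rw [← Finset.card_univ, Finset.card_eq_two] at h
      obtain ⟨a, a', -, h⟩ := h
      refine ⟨a, a', fun x => ?_⟩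
      have := Finset.mem_univ x
      rw [h] at this
      simpa using this
  obtain ⟨i, hi, hia⟩ := hy (mem_range_self a)
  obtain ⟨i', hi', hia'⟩ := hy (mem_range_self a')
  refine ⟨i, hi, i', hi', ?_⟩
  rw [hia, hia', ← convexHull_pair]
  refine convexHull_mono ?_ hzy
  rintro _ ⟨x, rfl⟩
  rcases ha x with rfl | rfl <;> simp

/-- A segment leaving the hull of planar points crosses a segment joining two of them. -/
theorem exists_crossing (hE : Module.finrank ℝ E = 2) {b : ι → E} {S : Set ι}
    {x y : E} (hx : x ∈ convexHull ℝ (b '' S)) (hy : y ∉ convexHull ℝ (b '' S)) :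
    ∃ z ∈ segment ℝ x y, z ∈ convexHull ℝ (b '' S) ∧
      ∃ i ∈ S, ∃ i' ∈ S, z ∈ segment ℝ (b i) (b i') := by
  set K := convexHull ℝ (b '' S) with hK
  have hKc : IsCompact K := isCompact_convexHull_image b S
  set g : ℝ → E := fun t => AffineMap.lineMap x y t with hg
  have hgc : Continuous g := AffineMap.lineMap_continuous
  have hT : IsCompact (Icc (0 : ℝ) 1 ∩ g ⁻¹' K) :=
    isCompact_Icc.inter_right (hKc.isClosed.preimage hgc)
  -- The crossing is the last parameter at which the segment is still in the hull; it cannot be an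
  -- interior point.
  obtain ⟨t, ⟨ht, htK⟩, htmax⟩ := hT.exists_isMaxOn ⟨0, by simp [hg, hx]⟩ continuousOn_id
  have ht1 : t < 1 := by
    refine lt_of_le_of_ne ht.2 ?_
    rintro rfl
    exact hy (by simpa [hg] using htK)
  refine ⟨g t, ?_, htK, ?_⟩
  · rw [segment_eq_image_lineMap]
    exact ⟨t, ht, rfl⟩
  · refine exists_segment_of_notMem_interior hE htK fun hint => ?_
    have h1 : ∀ᶠ s in 𝓝[>] t, g s ∈ K :=
      nhdsWithin_le_nhds (hgc.continuousAt.preimage_mem_nhds (mem_interior_iff_mem_nhds.1 hint))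
    have h2 : ∀ᶠ s in 𝓝[>] t, s < 1 := nhdsWithin_le_nhds (Iio_mem_nhds ht1)
    obtain ⟨s, hs1, hs2, hs3⟩ := (h1.and (h2.and self_mem_nhdsWithin)).exists
    have hs3 : t < s := hs3
    have := htmax ⟨⟨ht.1.trans hs3.le, hs2.le⟩, hs1⟩
    exact absurd this (not_le.2 hs3)

/-- The kernel of a nonzero functional on the plane is a line. -/
theorem exists_ker_direction (hE : Module.finrank ℝ E = 2) {q : StrongDual ℝ E} (hq : q ≠ 0) :
    ∃ v : E, v ≠ 0 ∧ q v = 0 ∧ ∀ x, q x = 0 → ∃ t : ℝ, x = t • v := by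
  have hq' : (q : E →ₗ[ℝ] ℝ) ≠ 0 := by
    intro h
    apply hq
    ext x
    exact LinearMap.congr_fun h x
  have h1 := LinearMap.finrank_range_add_finrank_ker (q : E →ₗ[ℝ] ℝ)
  rw [LinearMap.range_eq_top.2 (LinearMap.surjective hq'), finrank_top, Module.finrank_self,
    hE] at h1
  have h2 : Module.finrank ℝ (LinearMap.ker (q : E →ₗ[ℝ] ℝ)) = 1 := by omega
  obtain ⟨v, hv, h⟩ := finrank_eq_one_iff'.1 h2
  refine ⟨v, by simpa using hv, v.2, fun x hx => ?_⟩
  obtain ⟨t, ht⟩ := h ⟨x, hx⟩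
  exact ⟨t, by simpa using (congrArg Subtype.val ht).symm⟩

theorem exists_line_param (hE : Module.finrank ℝ E = 2) {q : StrongDual ℝ E} (hq : q ≠ 0)
    {x y z : E} (hxy : q x = q y) (hxz : q x = q z) (hne : x ≠ y) :
    ∃ t : ℝ, z = x + t • (y - x) := by
  obtain ⟨v, hv, -, h⟩ := exists_ker_direction hE hq
  obtain ⟨s, hs⟩ := h (y - x) (by simp [hxy])
  obtain ⟨t, ht⟩ := h (z - x) (by simp [hxz])
  have hs0 : s ≠ 0 := by
    rintro rfl
    exact hne (sub_eq_zero.1 (by simpa using hs)).symm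
  refine ⟨t / s, ?_⟩
  rw [hs, smul_smul, div_mul_cancel₀ _ hs0, ← ht]
  abel

theorem line_mem_segment {x v : E} {r s t : ℝ} (h : r ∈ segment ℝ s t) :
    x + r • v ∈ segment ℝ (x + s • v) (x + t • v) := by
  obtain ⟨α, β, hα, hβ, hαβ, rfl⟩ := h
  refine ⟨α, β, hα, hβ, hαβ, ?_⟩
  have e : α • (x + s • v) + β • (x + t • v) = (α + β) • x + (α • s + β • t) • v := by
    simp only [smul_eq_mul]; module
  rw [e, hαβ, one_smul]

/-- A functional that is at least `q z` at both ends of a segment, with `z` strictly inside, is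
constant on it. -/
theorem functional_eq_of_mem_segment {q : StrongDual ℝ E} {x y z : E} (hz : z ∈ segment ℝ x y)
    (hzx : z ≠ x) (hzy : z ≠ y) (hx : q z ≤ q x) (hy : q z ≤ q y) : q x = q z ∧ q y = q z := by
  obtain ⟨α, β, hα, hβ, hαβ, rfl⟩ := hz
  have hα0 : α ≠ 0 := by
    rintro rfl
    have : β = 1 := by linarith
    simp [this] at hzy
  have hβ0 : β ≠ 0 := by
    rintro rfl
    have : α = 1 := by linarith
    simp [this] at hzx
  have hα' : 0 < α := lt_of_le_of_ne hα (Ne.symm hα0)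
  have hβ' : 0 < β := lt_of_le_of_ne hβ (Ne.symm hβ0)
  simp only [map_add, map_smul, smul_eq_mul] at *
  have h1 : α = 1 - β := by linarith
  subst h1
  constructor <;> nlinarith

/-- The segment `b i, b j` is an edge of the hull of `b i, b j, b k, b l`. -/
def HullEdge (b : ι → E) (i j k l : ι) : Prop :=
  (∃ q : StrongDual ℝ E, q ≠ 0 ∧ q (b i) = q (b j) ∧ q (b i) ≤ q (b k) ∧ q (b i) ≤ q (b l)) ∧
    b k ∉ segment ℝ (b i) (b j) ∧ b l ∉ segment ℝ (b i) (b j)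

/-- A hull edge can only meet the segment of the other two points by lying inside it. -/
theorem HullEdge.mem_segment (hE : Module.finrank ℝ E = 2) {b : ι → E} {i i' j k : ι}
    (h : HullEdge b i i' j k) {z : E} (hz : z ∈ segment ℝ (b i) (b i'))
    (hz' : z ∈ segment ℝ (b j) (b k)) :
    b i ∈ segment ℝ (b j) (b k) ∧ b i' ∈ segment ℝ (b j) (b k) := by
  obtain ⟨⟨q, hq, hii, hij, hik⟩, hj, hk⟩ := h
  have hzj : z ≠ b j := by rintro rfl; exact hj hz
  have hzk : z ≠ b k := by rintro rfl; exact hk hz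
  have hqz : q z = q (b i) := by
    obtain ⟨α, β, -, -, hαβ, rfl⟩ := hz
    simp only [map_add, map_smul, smul_eq_mul, ← hii]
    rw [← add_mul, hαβ, one_mul]
  obtain ⟨h1, h2⟩ := functional_eq_of_mem_segment hz' hzj hzk (hqz ▸ hij) (hqz ▸ hik)
  obtain ⟨v, hv, -, hline⟩ := exists_ker_direction hE hq
  have hpar : ∀ x, q x = q z → ∃ t : ℝ, x = z + t • v := by
    intro x hx
    obtain ⟨t, ht⟩ := hline (x - z) (by simp [hx])
    exact ⟨t, by rw [← ht]; abel⟩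
  obtain ⟨ti, hti⟩ := hpar (b i) hqz.symm
  obtain ⟨ti', hti'⟩ := hpar (b i') (by rw [hqz, hii])
  obtain ⟨tj, htj⟩ := hpar (b j) h1
  obtain ⟨tk, htk⟩ := hpar (b k) h2
  have key : ∀ {x y s t : _}, x = z + s • v → y = z + t • v → z ∈ segment ℝ x y →
      (0 : ℝ) ∈ segment ℝ s t := by
    rintro _ _ s t rfl rfl ⟨α, β, hα, hβ, hαβ, h⟩
    refine ⟨α, β, hα, hβ, hαβ, ?_⟩
    have h3 : (α * s + β * t) • v = 0 := by
      have e : α • (z + s • v) + β • (z + t • v) = (α + β) • z + (α * s + β * t) • v := by module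
      rw [e, hαβ, one_smul] at h
      simpa using h
    exact (smul_eq_zero.1 h3).resolve_right hv
  -- All four points lie on one line with origin `z`. Both parameter intervals contain `0`, and
  -- neither end of the second lies in the first, so the first is contained in the second.
  have e1 := key hti hti' hz
  have e2 := key htj htk hz'
  have n1 : tj ∉ segment ℝ ti ti' := by
    intro h
    apply hj
    rw [hti, hti', htj]
    exact line_mem_segment h
  have n2 : tk ∉ segment ℝ ti ti' := by
    intro h
    apply hk
    rw [hti, hti', htk]
    exact line_mem_segment h
  rw [hti, hti', htj, htk]
  rw [segment_eq_uIcc, mem_uIcc] at e1 e2 n1 n2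
  constructor <;> refine line_mem_segment ?_ <;> rw [segment_eq_uIcc, mem_uIcc] <;> grind

end Plane

/-! ### Compatible colorings: hulls of color classes and bicolored edges -/

section Colored

variable {ι E : Type*} [Fintype ι] [NormedAddCommGroup E] [NormedSpace ℝ E]
  [FiniteDimensional ℝ E]

/-- The segments inside one color class do not cross the segments outside it, in the sense of
compatibility. -/
def ColoringCompatible (b : ι → E) (κ : ι → Fin 3) : Prop :=
  ∀ i i' j k, i ≠ i' → j ≠ k → κ i = κ i' → κ j ≠ κ i → κ k ≠ κ i →
    HullEdge b i i' j k ∨ HullEdge b j k i i'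

variable {b : ι → E} {κ : ι → Fin 3}

/-- If a point of another color lies between two points of one color, then all points of other
colors lie on the line through these. -/
theorem ColoringCompatible.line_of_between (hκ : ColoringCompatible b κ)
    (hE : Module.finrank ℝ E = 2) (hinj : Function.Injective b) {i i' j : ι}
    (hii : κ i = κ i') (hj : κ j ≠ κ i) (hz : b j ∈ segment ℝ (b i) (b i')) {k : ι}
    (hk : κ k ≠ κ i) : ∃ t : ℝ, b k = b i + t • (b i' - b i) := by
  have hji : j ≠ i := fun h => hj (h ▸ rfl)
  have hji' : j ≠ i' := fun h => hj (h ▸ hii.symm)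
  have hne : i ≠ i' := by
    rintro rfl
    rw [segment_same] at hz
    exact hji (hinj hz)
  rcases eq_or_ne j k with rfl | hjk
  · rw [segment_eq_image'] at hz
    obtain ⟨t, -, ht⟩ := hz
    exact ⟨t, ht.symm⟩
  rcases hκ i i' j k hne hjk hii hj hk with h | h
  · exact absurd hz h.2.1
  · obtain ⟨⟨q, hq, hqjk, hqi, hqi'⟩, -, -⟩ := h
    obtain ⟨h1, h2⟩ := functional_eq_of_mem_segment hz (hinj.ne hji) (hinj.ne hji') hqi hqi'
    exact exists_line_param hE hq (h1.trans h2.symm) (h1.trans hqjk) (hinj.ne hne)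

/-- If the hull of a color class contains a point of another color, it contains all of them. -/
theorem ColoringCompatible.outer (hκ : ColoringCompatible b κ)
    (hE : Module.finrank ℝ E = 2) (hinj : Function.Injective b) {m : Fin 3} {k : ι}
    (hkm : κ k ≠ m) (hk : b k ∈ convexHull ℝ (b '' {i | κ i = m})) {i : ι} (him : κ i ≠ m) :
    b i ∈ convexHull ℝ (b '' {i | κ i = m}) := by
  by_contra hi
  have hki : k ≠ i := by rintro rfl; exact hi hk
  obtain ⟨z, hz, -, j, hj, j', hj', hzj⟩ := exists_crossing hE hk hi
  have hj : κ j = m := hj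
  have hj' : κ j' = m := hj'
  -- Of the two alternatives of compatibility for the crossing segments, one puts a point of color
  -- `m` between `b k` and `b i`; the other puts `b i` back into the hull.
  obtain ⟨j, hj, hjs⟩ : ∃ j, κ j = m ∧ b j ∈ segment ℝ (b k) (b i) := by
    rcases eq_or_ne j j' with rfl | hjj
    · rw [segment_same] at hzj
      exact ⟨j, hj, hzj ▸ hz⟩
    · rcases hκ j j' k i hjj hki (hj.trans hj'.symm) (hj ▸ hkm) (hj ▸ him) with h | h
      · exact ⟨j, hj, (h.mem_segment hE hzj hz).1⟩
      · refine absurd ?_ hi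
        exact segment_subset_convexHull_image (S := {i | κ i = m}) hj hj'
          (h.mem_segment hE hz hzj).2
  have hjk : j ≠ k := by rintro rfl; exact hkm hj
  have hji : j ≠ i := by rintro rfl; exact him hj
  set u := b i - b k with hu
  have hu0 : u ≠ 0 := sub_ne_zero.2 (hinj.ne hki.symm)
  obtain ⟨s, hs, hsj⟩ : ∃ s : ℝ, 0 < s ∧ b j = b k + s • u := by
    rw [segment_eq_image'] at hjs
    obtain ⟨s, hs, h⟩ := hjs
    refine ⟨s, lt_of_le_of_ne hs.1 ?_, h.symm⟩
    rintro rfl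
    exact hjk (hinj (by simpa using h.symm))
  -- the whole color class lies on one side of `b k` on the line through `b k` and `b i`
  have hside : b '' {i | κ i = m} ⊆ {x | ∃ t : ℝ, 0 < t ∧ x = b k + t • u} := by
    rintro _ ⟨l, hl, rfl⟩
    have hl : κ l = m := hl
    rcases eq_or_ne j l with rfl | hjl
    · exact ⟨s, hs, hsj⟩
    rcases hκ j l k i hjl hki (hj.trans hl.symm) (hj ▸ hkm) (hj ▸ him) with h | h
    · obtain ⟨⟨q, hq, hqjl, hqk, hqi⟩, hkn, -⟩ := h
      obtain ⟨h1, h2⟩ := functional_eq_of_mem_segment hjs (hinj.ne hjk) (hinj.ne hji) hqk hqi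
      obtain ⟨t, ht⟩ := exists_line_param hE hq (h1.trans h2.symm) (h1.trans hqjl) (hinj.ne hki)
      refine ⟨t, ?_, ht⟩
      by_contra! ht0
      apply hkn
      rw [hsj, ht]
      have := line_mem_segment (x := b k) (v := u) (r := 0) (s := s) (t := t) (by
        rw [segment_eq_uIcc, mem_uIcc]; right; exact ⟨ht0, hs.le⟩)
      simpa using this
    · exact absurd hjs h.2.1
  have hconv : Convex ℝ {x | ∃ t : ℝ, 0 < t ∧ x = b k + t • u} := by
    rintro _ ⟨t, ht, rfl⟩ _ ⟨r, hr, rfl⟩ α β hα hβ hαβ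
    refine ⟨α * t + β * r, ?_, ?_⟩
    · rcases hα.eq_or_lt with rfl | hα
      · have : β = 1 := by linarith
        simpa [this] using hr
      · positivity
    · have e : α • (b k + t • u) + β • (b k + r • u) = (α + β) • b k + (α * t + β * r) • u := by
        module
      rw [e, hαβ, one_smul]
  -- The hull of the class lies in an open ray that omits its origin `b k`.
  obtain ⟨t, ht, h⟩ := convexHull_min hside hconv hk
  have : t • u = 0 := by simpa using h
  rcases smul_eq_zero.1 this with h | h
  · exact ht.ne' h
  · exact hu0 h

/-- If the hulls of two color classes meet, one of them contains all points of other colors. -/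
theorem ColoringCompatible.outer_of_not_disjoint (hκ : ColoringCompatible b κ)
    (hE : Module.finrank ℝ E = 2) (hinj : Function.Injective b) {x y : Fin 3} (hxy : x ≠ y) {z : E}
    (hzx : z ∈ convexHull ℝ (b '' {i | κ i = x})) (hzy : z ∈ convexHull ℝ (b '' {i | κ i = y})) :
    (∀ i, κ i ≠ x → b i ∈ convexHull ℝ (b '' {i | κ i = x})) ∨
      (∀ i, κ i ≠ y → b i ∈ convexHull ℝ (b '' {i | κ i = y})) := by
  by_contra! hcon
  obtain ⟨⟨i₁, hi₁, hi₁'⟩, ⟨i₂, hi₂, hi₂'⟩⟩ := hcon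
  have hx : ∀ k, κ k ≠ x → b k ∉ convexHull ℝ (b '' {i | κ i = x}) :=
    fun k hk hk' => hi₁' (hκ.outer hE hinj hk hk' hi₁)
  have hy : ∀ k, κ k ≠ y → b k ∉ convexHull ℝ (b '' {i | κ i = y}) :=
    fun k hk hk' => hi₂' (hκ.outer hE hinj hk hk' hi₂)
  have hseg : ∀ {m : Fin 3} {i j}, κ i = m → κ j = m →
      segment ℝ (b i) (b j) ⊆ convexHull ℝ (b '' {i | κ i = m}) := fun hi hj =>
    segment_subset_convexHull_image (S := {i | κ i = _}) hi hj
  obtain ⟨_, j, hj, -⟩ := convexHull_nonempty_iff.1 ⟨z, hzx⟩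
  have hj : κ j = x := hj
  -- From `z` toward a point of color `x`, the hull of `y` is left at `w` on a segment of color `y`;
  -- along that segment the hull of `x` is left at `v` on a segment of color `x`. The two segments
  -- meet at `v`, and compatibility places an end of one inside the other.
  obtain ⟨w, hw, hwy, k, hk, k', hk', hwk⟩ := exists_crossing hE hzy (hy j (hj ▸ hxy))
  have hk : κ k = y := hk
  have hk' : κ k' = y := hk'
  have hwx : w ∈ convexHull ℝ (b '' {i | κ i = x}) :=
    (convex_convexHull ℝ _).segment_subset hzx (subset_convexHull ℝ _ ⟨j, hj, rfl⟩) hw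
  obtain ⟨v, hv, -, i, hi, i', hi', hvi⟩ := exists_crossing hE hwx (hx k (hk ▸ hxy.symm))
  have hi : κ i = x := hi
  have hi' : κ i' = x := hi'
  have hvk : v ∈ segment ℝ (b k) (b k') :=
    (convex_segment _ _).segment_subset hwk (left_mem_segment ℝ _ _) hv
  rcases eq_or_ne i i' with rfl | hii
  · rw [segment_same] at hvi
    exact hy i (hi ▸ hxy) (hseg hk hk' (hvi ▸ hvk))
  rcases eq_or_ne k k' with rfl | hkk
  · rw [segment_same] at hvk
    exact hx k (hk ▸ hxy.symm) (hseg hi hi' (hvk ▸ hvi))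
  rcases hκ i i' k k' hii hkk (hi.trans hi'.symm) (by rw [hk, hi]; exact hxy.symm)
    (by rw [hk', hi]; exact hxy.symm) with h | h
  · exact hy i (hi ▸ hxy) (hseg hk hk' (h.mem_segment hE hvi hvk).1)
  · exact hx k (hk ▸ hxy.symm) (hseg hi hi' (h.mem_segment hE hvk hvi).1)

/-- Two color classes cannot both have the whole support in their hull. -/
theorem not_outer_of_outer [Nonempty ι] (hinj : Function.Injective b) {x y : Fin 3} (hxy : x ≠ y)
    (hx : ∀ i, κ i ≠ x → b i ∈ convexHull ℝ (b '' {i | κ i = x}))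
    (hy : ∀ i, κ i ≠ y → b i ∈ convexHull ℝ (b '' {i | κ i = y})) : False := by
  have key : ∀ m, (∀ i, κ i ≠ m → b i ∈ convexHull ℝ (b '' {i | κ i = m})) →
      convexHull ℝ (b '' {i | κ i = m}) = convexHull ℝ (range b) := by
    intro m hm
    refine subset_antisymm (convexHull_mono (image_subset_range _ _))
      (convexHull_min ?_ (convex_convexHull ℝ _))
    rintro _ ⟨i, rfl⟩
    by_cases hi : κ i = m
    · exact subset_convexHull ℝ _ ⟨i, hi, rfl⟩
    · exact hm i hi
  -- The two hulls would coincide, and an extreme point of them would have both colors.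
  obtain ⟨e, he⟩ := ((finite_range b).isCompact_convexHull ℝ).extremePoints_nonempty
    (convexHull_nonempty_iff.2 (range_nonempty b))
  have h1 := he
  rw [← key x hx] at h1
  rw [← key y hy] at he
  obtain ⟨i, hi, rfl⟩ := extremePoints_convexHull_subset h1
  obtain ⟨j, hj, hji⟩ := extremePoints_convexHull_subset he
  obtain rfl := hinj hji
  exact hxy (Eq.trans (Eq.symm hi) hj)

/-- A vertex of a cell of a maximal subdivision does not lie between two others. -/
theorem MaximalHeights.eq_or_eq_of_mem_segment [Nonempty ι] {c : ι → ℝ}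
    (hmax : MaximalHeights b c) (hinj : Function.Injective b) (hb : affineSpan ℝ (range b) = ⊤)
    {p : StrongDual ℝ E} {i i' k : ι} (hi : i ∈ cell b c p) (hi' : i' ∈ cell b c p)
    (hk : b k ∈ segment ℝ (b i) (b i')) : k = i ∨ k = i' := by
  classical
  by_contra! hne
  have hkc : k ∈ cell b c p := hmax.mem_cell_of_mem_hull hinj hb
    (segment_subset_convexHull_image hi hi' hk)
  obtain ⟨α, β, hα, hβ, hαβ, h⟩ := hk
  have := hmax.eq_zero_of_relation hinj hb (p := p)
    (r := Pi.single i α + Pi.single i' β - Pi.single k 1) (fun j hj => ?_) ?_ ?_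
  · have := congrFun this k
    simp [hne.1, hne.2] at this
  · have h1 : j ≠ i := by rintro rfl; exact hj hi
    have h2 : j ≠ i' := by rintro rfl; exact hj hi'
    have h3 : j ≠ k := by rintro rfl; exact hj hkc
    simp [h1, h2, h3]
  · simp [Finset.sum_add_distrib, hαβ]
  · simp [add_smul, sub_smul, Finset.sum_add_distrib, Pi.single_apply, h]

/-- Two color classes whose connecting segment avoids the edges of the third class are joined by an
edge of the subdivision. -/
theorem exists_bicolored_cell_of_good [Nonempty ι] {c : ι → ℝ}
    (hmax : MaximalHeights b c) (hE : Module.finrank ℝ E = 2) (hinj : Function.Injective b)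
    (hb : affineSpan ℝ (range b) = ⊤)
    {x y m : Fin 3} (hxm : x ≠ m) (hm : ∀ a : Fin 3, a = x ∨ a = y ∨ a = m)
    {j k : ι} (hj : κ j = x) (hk : κ k = y)
    (hgood : ∀ p, ∀ i ∈ cell b c p, ∀ i' ∈ cell b c p, κ i = m → κ i' = m →
      ∀ z ∈ segment ℝ (b i) (b i'), z ∉ segment ℝ (b j) (b k)) :
    ∃ p, ∃ i ∈ cell b c p, ∃ l ∈ cell b c p, κ i = x ∧ κ l = y := by
  classical
  -- `A a` is the union of the cells having a vertex of color `a`. The sets `A x` and `A y` cover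
  -- the segment: a cell purely of color `m` could only be left through a segment between its
  -- vertices, which `hgood` forbids.
  set A : Fin 3 → Set E := fun a => ⋃ M ∈ {M | M ∈ range (fun p => cell b c p) ∧ ∃ i ∈ M, κ i = a},
    convexHull ℝ (b '' M) with hA
  have hAcl : ∀ a, IsClosed (A a) := fun a =>
    (Set.toFinite _).isClosed_biUnion fun M _ => (isCompact_convexHull_image b M).isClosed
  have hAmem : ∀ {a p i z}, i ∈ cell b c p → κ i = a → z ∈ convexHull ℝ (b '' cell b c p) →
      z ∈ A a := fun {a p i z} hi ha hz => mem_biUnion (x := cell b c p) ⟨⟨p, rfl⟩, i, hi, ha⟩ hz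
  have hend : ∀ l, b l ∈ A (κ l) := by
    intro l
    obtain ⟨p, hp⟩ := hmax.exists_mem_cell hinj hb l
    exact hAmem hp rfl (subset_convexHull ℝ _ ⟨l, hp, rfl⟩)
  have hcover : segment ℝ (b j) (b k) ⊆ A x ∪ A y := by
    intro z hz
    have hzr : z ∈ convexHull ℝ (range b) := (convex_convexHull ℝ _).segment_subset
      (subset_convexHull ℝ _ (mem_range_self j)) (subset_convexHull ℝ _ (mem_range_self k)) hz
    obtain ⟨p, hp⟩ := exists_mem_cell hb c hzr
    by_contra hcon
    rw [mem_union, not_or] at hcon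
    have hall : ∀ i ∈ cell b c p, κ i = m := by
      intro i hi
      rcases hm (κ i) with h | h | h
      · exact absurd (hAmem hi h hp) hcon.1
      · exact absurd (hAmem hi h hp) hcon.2
      · exact h
    have hjn : b j ∉ convexHull ℝ (b '' cell b c p) := fun h =>
      hxm (hj.symm.trans (hall j (hmax.mem_cell_of_mem_hull hinj hb h)))
    obtain ⟨w, hw, -, i, hi, i', hi', hwi⟩ := exists_crossing hE hp hjn
    exact hgood p i hi i' hi' (hall i hi) (hall i' hi') w hwi
      ((convex_segment _ _).segment_subset hz (left_mem_segment ℝ _ _) hw)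
  obtain ⟨z, hz, hzx, hzy⟩ := isPreconnected_closed_iff.1
    (convex_segment (𝕜 := ℝ) (b j) (b k)).isPreconnected _ _ (hAcl x) (hAcl y) hcover
    ⟨b j, left_mem_segment ℝ _ _, hj ▸ hend j⟩ ⟨b k, right_mem_segment ℝ _ _, hk ▸ hend k⟩
  obtain ⟨_, ⟨⟨p, rfl⟩, i, hi, hix⟩, hzp⟩ := mem_iUnion₂.1 hzx
  obtain ⟨_, ⟨⟨q, rfl⟩, l, hl, hly⟩, hzq⟩ := mem_iUnion₂.1 hzy
  obtain ⟨v, hv0, hvS, hv1, hvz⟩ := mem_convexHull_image_iff.1 hzp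
  obtain ⟨w, hw0, hwS, hw1, hwz⟩ := mem_convexHull_image_iff.1 hzq
  by_contra! hno
  -- The vertices carrying `z` belong to both cells, so color `x` or `y` among them would give a
  -- bicolored cell. They all have color `m`, and since the cell also has the vertex `i` of color
  -- `x`, at most two remain; `z` then lies on a forbidden edge.
  have hsupp : ∀ r, v r ≠ 0 → r ∈ cell b c p ∧ κ r = m := by
    intro r hr
    have hrp : r ∈ cell b c p := by
      by_contra h
      exact hr (hvS r h)
    have hrq : r ∈ cell b c q :=
      support_subset_of_two_cells hv0 hvS hv1 hw0 hwS hw1 (hvz.trans hwz.symm) hr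
    refine ⟨hrp, ?_⟩
    rcases hm (κ r) with h | h | h
    · exact absurd hly (hno q r hrq l hl h)
    · exact absurd h (hno p i hi r hrp hix)
    · exact h
  set T : Finset ι := Finset.univ.filter fun r => r ∈ cell b c p ∧ κ r = m with hT
  have hTmem : ∀ r, r ∈ T ↔ r ∈ cell b c p ∧ κ r = m := by simp [hT]
  have hzT : z ∈ convexHull ℝ (b '' T) := by
    refine mem_convexHull_image_iff.2 ⟨v, hv0, fun r hr => ?_, hv1, hvz⟩
    by_contra h
    exact hr ((hTmem r).2 (hsupp r h))
  have hiT : i ∉ T := fun h => hxm (hix.symm.trans ((hTmem i).1 h).2)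
  have hcard := hmax.card_le hinj hb hE p (insert i T) (by
    intro r hr
    rcases Finset.mem_insert.1 (Finset.mem_coe.1 hr) with rfl | h
    · exact hi
    · exact ((hTmem r).1 h).1)
  rw [Finset.card_insert_of_notMem hiT] at hcard
  have hTne : T.Nonempty := by
    obtain ⟨_, r, hr, -⟩ := convexHull_nonempty_iff.1 ⟨z, hzT⟩
    exact ⟨r, hr⟩
  obtain ⟨s, t, hst⟩ : ∃ s t, T = {s, t} := by
    have := hTne.card_pos
    have h12 : T.card = 1 ∨ T.card = 2 := by omega
    rcases h12 with h | h
    · obtain ⟨s, hs⟩ := Finset.card_eq_one.1 h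
      exact ⟨s, s, by simp [hs]⟩
    · obtain ⟨s, t, -, h⟩ := Finset.card_eq_two.1 h
      exact ⟨s, t, h⟩
  have hs := (hTmem s).1 (by simp [hst])
  have ht := (hTmem t).1 (by simp [hst])
  refine hgood p s hs.1 t ht.1 hs.2 ht.2 z ?_ hz
  rw [hst] at hzT
  simpa [image_pair, convexHull_pair] using hzT

end Colored

/-! ### Connected level sets of uniformly increasing functions -/

section Connected

variable {D : Type*} [NormedAddCommGroup D] [NormedSpace ℝ D]

/-- The zero set and the nonnegative set of a continuous function that increases at a uniform rate
in some direction are connected, and every line in that direction meets the zero set. -/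
theorem isPreconnected_of_increasing {F : D → ℝ} (hF : Continuous F) {q : D} {δ : ℝ} (hδ : 0 < δ)
    (h : ∀ p t, 0 ≤ t → F p + δ * t ≤ F (p + t • q)) :
    (∀ p, ∃ t : ℝ, F (p + t • q) = 0) ∧ IsPreconnected {p | F p = 0} ∧
      IsPreconnected {p | 0 ≤ F p} := by
  have hst : ∀ p (s t : ℝ), s ≤ t → F (p + s • q) + δ * (t - s) ≤ F (p + t • q) := by
    intro p s t hst
    have := h (p + s • q) (t - s) (by linarith)
    rwa [add_assoc, ← add_smul, add_sub_cancel] at this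
  have hex : ∀ p, ∃ t : ℝ, F (p + t • q) = 0 := by
    intro p
    have hc : Continuous fun t : ℝ => F (p + t • q) := by fun_prop
    refine mem_range_of_exists_le_of_exists_ge hc ⟨-(|F p| / δ), ?_⟩ ⟨|F p| / δ, ?_⟩
    · have := hst p (-(|F p| / δ)) 0 (by simp; positivity)
      have e : δ * (|F p| / δ) = |F p| := by field_simp
      rw [zero_smul, add_zero, sub_neg_eq_add, zero_add, e] at this
      linarith [le_abs_self (F p)]
    · have := hst p 0 (|F p| / δ) (by positivity)
      have e : δ * (|F p| / δ) = |F p| := by field_simp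
      rw [zero_smul, add_zero, sub_zero, e] at this
      linarith [neg_abs_le (F p)]
  choose τ hτ using hex
  -- Uniform growth turns a small value of `F` into a small change of the crossing time, which makes
  -- `τ` continuous.
  have hbound : ∀ p p', δ * |τ p' - τ p| ≤ |F (p' + τ p • q)| := by
    intro p p'
    rcases le_total (τ p) (τ p') with hle | hle
    · have := hst p' _ _ hle
      rw [hτ] at this
      rw [abs_of_nonneg (by linarith)]
      linarith [neg_le_abs (F (p' + τ p • q))]
    · have := hst p' _ _ hle
      rw [hτ] at this
      rw [abs_of_nonpos (by linarith)]
      linarith [le_abs_self (F (p' + τ p • q))]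
  have hτc : Continuous τ := by
    rw [continuous_iff_continuousAt]
    intro p
    have h1 : Tendsto (fun p' => |F (p' + τ p • q)| / δ) (𝓝 p) (𝓝 (|F (p + τ p • q)| / δ)) :=
      Continuous.tendsto (by fun_prop) p
    rw [hτ, abs_zero, zero_div] at h1
    rw [ContinuousAt, tendsto_iff_dist_tendsto_zero]
    refine squeeze_zero (fun _ => dist_nonneg) (fun p' => ?_) h1
    rw [Real.dist_eq, le_div_iff₀ hδ, mul_comm]
    exact hbound p p'
  have hsign : ∀ p, 0 ≤ F p → τ p ≤ 0 := by
    intro p hp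
    by_contra! hlt
    have := hst p 0 (τ p) hlt.le
    rw [hτ, zero_smul, add_zero] at this
    nlinarith
  refine ⟨fun p => ⟨τ p, hτ p⟩, ?_, ?_⟩
  -- Both sets are continuous images of the whole space: slide along `q` onto the zero set, or only
  -- upward until `F` is nonnegative.
  · have e : {p | F p = 0} = range fun p => p + τ p • q := by
      ext p
      constructor
      · intro hp
        have hp : F p = 0 := hp
        refine ⟨p, ?_⟩
        have h1 := hsign p hp.ge
        have h2 := hst p (τ p) 0 h1
        rw [hτ, zero_smul, add_zero, hp] at h2
        have : τ p = 0 := by nlinarith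
        simp [this]
      · rintro ⟨p, rfl⟩
        exact hτ p
    rw [e]
    exact isPreconnected_range (by fun_prop)
  · have e : {p | 0 ≤ F p} = range fun p => p + (max (τ p) 0) • q := by
      ext p
      constructor
      · intro hp
        exact ⟨p, by simp [max_eq_right (hsign p hp)]⟩
      · rintro ⟨p, rfl⟩
        have := hst p (τ p) (max (τ p) 0) (le_max_left _ _)
        rw [hτ] at this
        have h2 : 0 ≤ δ * (max (τ p) 0 - τ p) :=
          mul_nonneg hδ.le (sub_nonneg.2 (le_max_left _ _))
        change 0 ≤ F (p + (max (τ p) 0) • q)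
        linarith
    rw [e]
    exact isPreconnected_range (by fun_prop)

end Connected

/-! ### The Sperner-type lemma -/

section Trichromatic

variable {ι E : Type*} [Fintype ι] [NormedAddCommGroup E] [NormedSpace ℝ E]
  [FiniteDimensional ℝ E]

theorem exists_functional_ne {b : ι → E} (hb : affineSpan ℝ (range b) = ⊤) {q : StrongDual ℝ E}
    (hq : q ≠ 0) (i : ι) : ∃ l, q (b l) ≠ q (b i) := by
  by_contra! hcon
  have key : ∀ x, q x = q (b i) := by
    intro x
    have hx : x ∈ affineSpan ℝ (range b) := hb ▸ AffineSubspace.mem_top ℝ E x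
    refine affineSpan_induction (p := fun x => q x = q (b i)) hx ?_ ?_
    · rintro _ ⟨l, rfl⟩
      exact hcon l
    · intro t u v w hu hv hw
      simp [hu, hv, hw]
  apply hq
  ext x
  have h0 := key 0
  rw [map_zero] at h0
  rw [key x, ← h0]
  rfl

theorem exists_functional_vanishing (hE : Module.finrank ℝ E = 2) (u : E) :
    ∃ q : StrongDual ℝ E, q ≠ 0 ∧ q u = 0 := by
  have hlt : Submodule.span ℝ {u} < ⊤ := by
    refine lt_top_iff_ne_top.2 fun h => ?_
    have h1 := finrank_span_le_card (R := ℝ) ({u} : Set E)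
    rw [h, finrank_top, hE] at h1
    simp at h1
  obtain ⟨f, hf, hle⟩ := Submodule.exists_le_ker_of_lt_top _ hlt
  refine ⟨LinearMap.toContinuousLinearMap f, ?_, ?_⟩
  · intro h
    apply hf
    ext x
    exact congrArg (fun g : StrongDual ℝ E => g x) h
  · exact hle (Submodule.mem_span_singleton_self u)

variable {b : ι → E} {κ : ι → Fin 3} {c : ι → ℝ}

/-- Any two color classes are joined by an edge of the subdivision. -/
theorem ColoringCompatible.exists_bicolored_cell [Nonempty ι] (hκ : ColoringCompatible b κ)
    (hmax : MaximalHeights b c) (hE : Module.finrank ℝ E = 2) (hinj : Function.Injective b)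
    (hb : affineSpan ℝ (range b) = ⊤) (hsurj : Function.Surjective κ)
    {x y m : Fin 3} (hxy : x ≠ y) (hxm : x ≠ m) (hym : y ≠ m)
    (hm : ∀ a : Fin 3, a = x ∨ a = y ∨ a = m) :
    ∃ p, ∃ i ∈ cell b c p, ∃ l ∈ cell b c p, κ i = x ∧ κ l = y := by
  by_contra hno
  have hbad : ∀ j k, κ j = x → κ k = y → ¬ ∀ p, ∀ i ∈ cell b c p, ∀ i' ∈ cell b c p,
      κ i = m → κ i' = m → ∀ z ∈ segment ℝ (b i) (b i'), z ∉ segment ℝ (b j) (b k) :=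
    fun j k hj hk hgood => hno (exists_bicolored_cell_of_good hmax hE hinj hb hxm hm hj hk hgood)
  obtain ⟨j, hj⟩ := hsurj x
  obtain ⟨k, hk⟩ := hsurj y
  have hjk : j ≠ k := by rintro rfl; exact hxy (hj.symm.trans hk)
  -- Some edge of color `m` meets the segment. By compatibility one of its ends lies on the segment,
  -- since a vertex of another color cannot lie on an edge of the triangulation.
  obtain ⟨i₀, hi₀, hi₀s⟩ : ∃ i, κ i = m ∧ b i ∈ segment ℝ (b j) (b k) := by
    have := hbad j k hj hk
    push Not at this
    obtain ⟨p, i, hi, i', hi', him, him', z, hz, hz'⟩ := this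
    rcases eq_or_ne i i' with rfl | hii
    · rw [segment_same] at hz
      exact ⟨i, him, hz ▸ hz'⟩
    rcases hκ i i' j k hii hjk (him.trans him'.symm) (by rw [hj, him]; exact hxm)
      (by rw [hk, him]; exact hym) with h | h
    · exact ⟨i, him, (h.mem_segment hE hz hz').1⟩
    · rcases hmax.eq_or_eq_of_mem_segment hinj hb hi hi' (h.mem_segment hE hz' hz).1 with rfl | rfl
      · exact absurd (hj.symm.trans him) hxm
      · exact absurd (hj.symm.trans him') hxm
  obtain ⟨q, hq, hqu⟩ := exists_functional_vanishing hE (b k - b j)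
  have hqk : q (b k) = q (b j) := by
    rw [map_sub] at hqu
    linarith
  -- As `i₀` lies between `j` and `k`, compatibility forces the whole class `m` onto their line.
  have hqm : ∀ i, κ i = m → q (b i) = q (b j) := by
    intro i hi
    have hline : ∃ t : ℝ, b i = b j + t • (b k - b j) := by
      rcases eq_or_ne i₀ i with rfl | hne
      · rw [segment_eq_image'] at hi₀s
        obtain ⟨t, -, ht⟩ := hi₀s
        exact ⟨t, ht.symm⟩
      rcases hκ i₀ i j k hne hjk (hi₀.trans hi.symm) (by rw [hj, hi₀]; exact hxm)
        (by rw [hk, hi₀]; exact hym) with h | h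
      · obtain ⟨⟨r, hr, hri, hrj, hrk⟩, -, -⟩ := h
        have h1 : i₀ ≠ j := by rintro rfl; exact hxm (hj.symm.trans hi₀)
        have h2 : i₀ ≠ k := by rintro rfl; exact hym (hk.symm.trans hi₀)
        obtain ⟨h3, h4⟩ := functional_eq_of_mem_segment hi₀s (hinj.ne h1) (hinj.ne h2) hrj hrk
        exact exists_line_param hE hr (h3.trans h4.symm) (h3.trans hri) (hinj.ne hjk)
      · exact absurd hi₀s h.2.1
    obtain ⟨t, ht⟩ := hline
    rw [ht, map_add, map_smul, hqu, smul_zero, add_zero]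
  obtain ⟨l, hl⟩ := exists_functional_ne hb hq j
  -- A segment from `l`, off the line, to `b e` on it meets the line only at `b e`, which is on no
  -- edge of color `m`. Such a segment is good, and one of them joins the colors `x` and `y`.
  have hgood : ∀ e, κ e ≠ m → q (b e) = q (b j) → ∀ p, ∀ i ∈ cell b c p, ∀ i' ∈ cell b c p,
      κ i = m → κ i' = m → ∀ z ∈ segment ℝ (b i) (b i'), z ∉ segment ℝ (b e) (b l) := by
    intro e he hqe p i hi i' hi' him him' z hz hz'
    have hqz : q z = q (b j) := by
      obtain ⟨α, β, -, -, hαβ, rfl⟩ := hz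
      simp only [map_add, map_smul, smul_eq_mul, hqm i him, hqm i' him']
      rw [← add_mul, hαβ, one_mul]
    have hze : z = b e := by
      obtain ⟨α, β, -, -, hαβ, rfl⟩ := hz'
      simp only [map_add, map_smul, smul_eq_mul, hqe] at hqz
      have : β * (q (b l) - q (b j)) = 0 := by
        have : α = 1 - β := by linarith
        rw [this] at hqz
        linarith
      have hβ := (mul_eq_zero.1 this).resolve_right (sub_ne_zero.2 hl)
      have hα : α = 1 := by linarith
      simp [hα, hβ]
    subst hze
    rcases hmax.eq_or_eq_of_mem_segment hinj hb hi hi' hz with rfl | rfl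
    · exact he him
    · exact he him'
  rcases hm (κ l) with h | h | h
  · refine hbad l k h hk fun p i hi i' hi' him him' z hz => ?_
    rw [segment_symm]
    exact hgood k (hk ▸ hym) hqk p i hi i' hi' him him' z hz
  · exact hbad j l hj h (hgood j (hj ▸ hxm) rfl)
  · exact hl (hqm l h)

/-- The minimum of the terms of one color. -/
noncomputable def colorMin (b : ι → E) (c : ι → ℝ) (κ : ι → Fin 3)
    (hsurj : Function.Surjective κ) (m : Fin 3) : StrongDual ℝ E → ℝ :=
  lowTerm b c (Finset.univ.filter fun i => κ i = m) (by
    obtain ⟨i, hi⟩ := hsurj m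
    exact ⟨i, by simpa using hi⟩)

variable (hsurj : Function.Surjective κ)

theorem continuous_colorMin (m : Fin 3) : Continuous (colorMin b c κ hsurj m) :=
  continuous_lowTerm _ _ _ _

theorem colorMin_le (i : ι) (p : StrongDual ℝ E) :
    colorMin b c κ hsurj (κ i) p ≤ c i + p (b i) :=
  Finset.inf'_le _ (by simp)

theorem exists_colorMin_eq (m : Fin 3) (p : StrongDual ℝ E) :
    ∃ i, κ i = m ∧ colorMin b c κ hsurj m p = c i + p (b i) := by
  obtain ⟨i, hi⟩ := hsurj m
  obtain ⟨i, hi, h⟩ := Finset.exists_mem_eq_inf' (s := Finset.univ.filter fun i => κ i = m)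
    ⟨i, by simpa using hi⟩ fun i => c i + p (b i)
  exact ⟨i, (Finset.mem_filter.1 hi).2, h⟩

theorem le_colorMin {m : Fin 3} {p : StrongDual ℝ E} {r : ℝ}
    (h : ∀ i, κ i = m → r ≤ c i + p (b i)) : r ≤ colorMin b c κ hsurj m p := by
  obtain ⟨i, hi, e⟩ := exists_colorMin_eq (b := b) (c := c) hsurj m p
  exact e ▸ h i hi

theorem colorMin_of_mem_cell {i : ι} {p : StrongDual ℝ E} (hi : i ∈ cell b c p) (m : Fin 3) :
    colorMin b c κ hsurj (κ i) p ≤ colorMin b c κ hsurj m p :=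
  le_colorMin hsurj fun l _ => (colorMin_le hsurj i p).trans (hi l)

/-- Separated color classes: the difference of the minima increases at a uniform rate in the
separating direction. -/
theorem colorMin_sub_increasing {x y : Fin 3}
    (hdisj : Disjoint (convexHull ℝ (b '' {i | κ i = x})) (convexHull ℝ (b '' {i | κ i = y}))) :
    ∃ q : StrongDual ℝ E, ∃ δ > 0, ∀ p t, 0 ≤ t →
      (colorMin b c κ hsurj x p - colorMin b c κ hsurj y p) + δ * t ≤
        colorMin b c κ hsurj x (p + t • q) - colorMin b c κ hsurj y (p + t • q) := by
  -- Along a strictly separating functional one minimum gains at least `v` per unit and the other at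
  -- most `u`, so the rate is `v - u`.
  obtain ⟨q, u, v, hq1, huv, hq2⟩ := geometric_hahn_banach_compact_closed (convex_convexHull ℝ _)
    (isCompact_convexHull_image b {i | κ i = y}) (convex_convexHull ℝ _)
    (isCompact_convexHull_image b {i | κ i = x}).isClosed hdisj.symm
  refine ⟨q, v - u, by linarith, fun p t ht => ?_⟩
  have h1 : colorMin b c κ hsurj x p + v * t ≤ colorMin b c κ hsurj x (p + t • q) := by
    refine le_colorMin hsurj fun i hi => ?_
    have h1 := colorMin_le (b := b) (c := c) hsurj i p
    have h2 := hq2 _ (subset_convexHull ℝ _ (mem_image_of_mem b hi))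
    simp only [_root_.add_apply, _root_.smul_apply, smul_eq_mul]
    rw [hi] at h1
    nlinarith
  have h2 : colorMin b c κ hsurj y (p + t • q) ≤ colorMin b c κ hsurj y p + u * t := by
    obtain ⟨i, hi, e⟩ := exists_colorMin_eq (b := b) (c := c) hsurj y p
    have h1 := colorMin_le (b := b) (c := c) hsurj i (p + t • q)
    have h2 := hq1 _ (subset_convexHull ℝ _ (mem_image_of_mem b (show i ∈ {i | κ i = y} from hi)))
    simp only [_root_.add_apply, _root_.smul_apply, smul_eq_mul] at h1
    rw [hi] at h1
    nlinarith
  linarith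

/-- A term that attains the minimum of its color attains the overall minimum once the three minima
agree. -/
theorem exists_trichromatic_of_eq {p : StrongDual ℝ E}
    (h : ∀ m m', colorMin b c κ hsurj m p = colorMin b c κ hsurj m' p) :
    ∃ p, ∀ m, ∃ i ∈ cell b c p, κ i = m := by
  refine ⟨p, fun m => ?_⟩
  obtain ⟨i, hi, e⟩ := exists_colorMin_eq (b := b) (c := c) hsurj m p
  refine ⟨i, fun l => ?_, hi⟩
  rw [← e, h m (κ l)]
  exact colorMin_le hsurj l p

/-- If the hull of the color class `m` contains all other points, then the minimum of that color
is the smallest one somewhere on any locus where the other two colors agree. -/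
theorem ColoringCompatible.exists_le_of_outer [Nonempty ι] (hκ : ColoringCompatible b κ)
    (hE : Module.finrank ℝ E = 2) (hinj : Function.Injective b)
    (hb : affineSpan ℝ (range b) = ⊤) {x y m : Fin 3} (hxm : x ≠ m) (hym : y ≠ m)
    (hout : ∀ i, κ i ≠ m → b i ∈ convexHull ℝ (b '' {i | κ i = m}))
    {p₀ : StrongDual ℝ E} (hp₀ : colorMin b c κ hsurj x p₀ = colorMin b c κ hsurj y p₀)
    {q : StrongDual ℝ E} (hq : ∀ p, ∃ t : ℝ, colorMin b c κ hsurj x (p + t • q) =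
      colorMin b c κ hsurj y (p + t • q)) :
    ∃ p, colorMin b c κ hsurj x p = colorMin b c κ hsurj y p ∧
      colorMin b c κ hsurj m p ≤ colorMin b c κ hsurj x p := by
  by_cases hbd : ∃ j i i', κ j ≠ m ∧ κ i = m ∧ κ i' = m ∧ b j ∈ segment ℝ (b i) (b i')
  · -- all other points lie on a line, and the minima `x`, `y` move in parallel off that line
    obtain ⟨j, i, i', hj, hi, hi', hs⟩ := hbd
    obtain ⟨r, hr, hru⟩ := exists_functional_vanishing hE (b i' - b i)
    have hrk : ∀ k, κ k ≠ m → r (b k) = r (b i) := by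
      intro k hk
      obtain ⟨t, ht⟩ := hκ.line_of_between hE hinj (hi.trans hi'.symm) (hi ▸ hj) hs (hi ▸ hk)
      rw [ht, map_add, map_smul, hru, smul_zero, add_zero]
    obtain ⟨r, hrk, l, hl⟩ : ∃ r : StrongDual ℝ E, (∀ k, κ k ≠ m → r (b k) = r (b i)) ∧
        ∃ l, r (b l) < r (b i) := by
      obtain ⟨l, hl⟩ := exists_functional_ne hb hr i
      rcases lt_or_gt_of_ne hl with h | h
      · exact ⟨r, hrk, l, h⟩
      · exact ⟨-r, fun k hk => by simp [hrk k hk], l, by simpa using h⟩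
    have hlm : κ l = m := by
      by_contra h
      exact hl.ne (hrk l h)
    have hshift : ∀ a, a ≠ m → ∀ s : ℝ, colorMin b c κ hsurj a (p₀ + s • r) =
        colorMin b c κ hsurj a p₀ + s * r (b i) := by
      intro a ha s
      apply le_antisymm
      · obtain ⟨k, hk, e⟩ := exists_colorMin_eq (b := b) (c := c) hsurj a p₀
        have := colorMin_le (b := b) (c := c) hsurj k (p₀ + s • r)
        simp only [_root_.add_apply, _root_.smul_apply, smul_eq_mul, hrk k (hk ▸ ha), hk] at this
        linarith
      · refine le_colorMin hsurj fun k hk => ?_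
        have := colorMin_le (b := b) (c := c) hsurj k p₀
        rw [hk] at this
        simp only [_root_.add_apply, _root_.smul_apply, smul_eq_mul, hrk k (hk ▸ ha)]
        linarith
    -- The shift at which the term of `l` meets the common minimum of `x` and `y`.
    set s : ℝ := (c l + p₀ (b l) - colorMin b c κ hsurj x p₀) / (r (b i) - r (b l)) with hs
    refine ⟨p₀ + s • r, by rw [hshift x hxm, hshift y hym, hp₀], ?_⟩
    have h1 := colorMin_le (b := b) (c := c) hsurj l (p₀ + s • r)
    have h2 : s * (r (b i) - r (b l)) = c l + p₀ (b l) - colorMin b c κ hsurj x p₀ := by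
      rw [hs, div_mul_cancel₀ _ (by linarith)]
    rw [hshift x hxm]
    simp only [_root_.add_apply, _root_.smul_apply, smul_eq_mul, hlm] at h1
    linarith
  · -- all other points are interior, and the locus is unbounded
    push Not at hbd
    have hint : ∀ j, κ j ≠ m → b j ∈ interior (convexHull ℝ (b '' {i | κ i = m})) := by
      intro j hj
      by_contra h
      obtain ⟨i, hi, i', hi', hs⟩ := exists_segment_of_notMem_interior hE (hout j hj) h
      exact hbd j i i' hj hi hi' hs
    have hR : ∀ j, ∃ R : ℝ, κ j ≠ m → ∀ p : StrongDual ℝ E, R ≤ ‖p‖ →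
        colorMin b c κ hsurj m p ≤ c j + p (b j) := by
      intro j
      by_cases hj : κ j = m
      · exact ⟨0, fun h => absurd hj h⟩
      obtain ⟨i, hi⟩ := hsurj m
      obtain ⟨ρ, hρ, C, hC⟩ := exists_lowTerm_le (b := b) c
        (S := Finset.univ.filter fun i => κ i = m) ⟨i, by simpa using hi⟩ (x := b j)
        (by simpa using hint j hj)
      refine ⟨(C - c j) / ρ, fun _ p hp => (hC p).trans ?_⟩
      rw [div_le_iff₀ hρ] at hp
      linarith
    choose R hR using hR
    obtain ⟨j₀, hj₀⟩ := Finite.exists_max R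
    -- Outside radius `R j₀` color `m` wins. Adding multiples of `q` does not change the value at
    -- `e`, so the correction `t • q` cannot bring the functional back inside that radius.
    obtain ⟨e, he, hqe⟩ : ∃ e : E, e ≠ 0 ∧ q e = 0 := by
      by_cases hq0 : q = 0
      · have : Nontrivial E := Module.nontrivial_of_finrank_pos (R := ℝ) (by omega)
        obtain ⟨e, he⟩ := exists_ne (0 : E)
        exact ⟨e, he, by simp [hq0]⟩
      · obtain ⟨v, hv, hqv, -⟩ := exists_ker_direction hE hq0
        exact ⟨v, hv, hqv⟩
    obtain ⟨r, -, hre⟩ := exists_dual_vector ℝ e (norm_ne_zero_iff.2 he)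
    obtain ⟨t, ht⟩ := hq (R j₀ • r)
    refine ⟨_, ht, ?_⟩
    have hnorm : R j₀ ≤ ‖R j₀ • r + t • q‖ := by
      have h1 := ContinuousLinearMap.le_opNorm (R j₀ • r + t • q) e
      simp only [_root_.add_apply, _root_.smul_apply, smul_eq_mul, hqe, hre, mul_zero,
        add_zero] at h1
      have hpos := norm_pos_iff.2 he
      have h2 := (le_abs_self _).trans h1
      exact le_of_mul_le_mul_right (by simpa using h2) hpos
    exact le_colorMin hsurj fun k hk => hR k (hk ▸ hxm) _ ((hj₀ k).trans hnorm)

/-- A Sperner-type lemma: a maximal regular triangulation with a compatible coloring has a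
triangle with three colors. -/
theorem ColoringCompatible.exists_trichromatic [Nonempty ι] (hκ : ColoringCompatible b κ)
    (hmax : MaximalHeights b c) (hE : Module.finrank ℝ E = 2) (hinj : Function.Injective b)
    (hb : affineSpan ℝ (range b) = ⊤) (hsurj : Function.Surjective κ) :
    ∃ p, ∀ m, ∃ i ∈ cell b c p, κ i = m := by
  set f := colorMin b c κ hsurj with hf
  have hfc : ∀ m, Continuous (f m) := continuous_colorMin hsurj
  -- A functional dual to a bicolored edge makes the two minima agree below the third.
  have hP : ∀ {x y m : Fin 3}, x ≠ y → x ≠ m → y ≠ m → ∃ p, f x p = f y p ∧ f x p ≤ f m p := by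
    intro x y m hxy hxm hym
    obtain ⟨p, i, hi, l, hl, rfl, rfl⟩ :=
      hκ.exists_bicolored_cell hmax hE hinj hb hsurj hxy hxm hym (by omega)
    exact ⟨p, le_antisymm (colorMin_of_mem_cell hsurj hi _) (colorMin_of_mem_cell hsurj hl _),
      colorMin_of_mem_cell hsurj hi _⟩
  by_cases hout : ∃ m, ∀ i, κ i ≠ m → b i ∈ convexHull ℝ (b '' {i | κ i = m})
  · obtain ⟨m, hm⟩ := hout
    obtain ⟨x, y, hxy, hxm, hym, hall⟩ : ∃ x y : Fin 3, x ≠ y ∧ x ≠ m ∧ y ≠ m ∧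
        ∀ a, a = x ∨ a = y ∨ a = m := ⟨m + 1, m + 2, by omega, by omega, by omega, by omega⟩
    have hdisj : Disjoint (convexHull ℝ (b '' {i | κ i = x}))
        (convexHull ℝ (b '' {i | κ i = y})) := by
      rw [Set.disjoint_left]
      intro z hzx hzy
      rcases hκ.outer_of_not_disjoint hE hinj hxy hzx hzy with h | h
      · exact not_outer_of_outer hinj hxm h hm
      · exact not_outer_of_outer hinj hym h hm
    obtain ⟨q, δ, hδ, hq⟩ := colorMin_sub_increasing (c := c) hsurj hdisj
    obtain ⟨hex, hconn, -⟩ := isPreconnected_of_increasing ((hfc x).sub (hfc y)) hδ hq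
    obtain ⟨p₁, hp₁, hp₁'⟩ := hP hxy hxm hym
    obtain ⟨p₂, hp₂, hp₂'⟩ := hκ.exists_le_of_outer hsurj hE hinj hb hxm hym hm hp₁
      (q := q) fun p => (hex p).imp fun t ht => sub_eq_zero.1 ht
    -- On the connected locus `f x = f y`, color `m` is lowest at `p₂` and highest at `p₁`, ties
    -- allowed.
    obtain ⟨p, hp, hpe⟩ := hconn.intermediate_value₂ (a := p₂) (b := p₁) (sub_eq_zero.2 hp₂)
      (sub_eq_zero.2 hp₁) (hfc m).continuousOn (hfc x).continuousOn hp₂' hp₁'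
    have hp : f x p = f y p := sub_eq_zero.1 hp
    refine exists_trichromatic_of_eq hsurj (p := p) fun a a' => ?_
    have key : ∀ a, f a p = f x p := by
      intro a
      rcases hall a with rfl | rfl | rfl
      · rfl
      · exact hp.symm
      · exact hpe
    exact (key a).trans (key a').symm
  · push Not at hout
    have hdisj : ∀ {x y : Fin 3}, x ≠ y → Disjoint (convexHull ℝ (b '' {i | κ i = x}))
        (convexHull ℝ (b '' {i | κ i = y})) := by
      intro x y hxy
      rw [Set.disjoint_left]
      intro z hzx hzy
      rcases hκ.outer_of_not_disjoint hE hinj hxy hzx hzy with h | h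
      · obtain ⟨i, hi, hi'⟩ := hout x
        exact hi' (h i hi)
      · obtain ⟨i, hi, hi'⟩ := hout y
        exact hi' (h i hi)
    by_contra hno
    have hne : ∀ p, f 0 p = f 1 p → f 1 p = f 2 p → False := by
      intro p h1 h2
      refine hno (exists_trichromatic_of_eq hsurj (p := p) fun a a' => ?_)
      have key : ∀ a, f a p = f 0 p := by
        intro a
        fin_cases a
        · rfl
        · exact h1.symm
        · exact (h1.trans h2).symm
      exact (key a).trans (key a').symm
    obtain ⟨p₀, h₀, h₀'⟩ := hP (x := 0) (y := 1) (m := 2) (by decide) (by decide) (by decide)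
    obtain ⟨p₁, h₁, h₁'⟩ := hP (x := 1) (y := 2) (m := 0) (by decide) (by decide) (by decide)
    obtain ⟨p₂, h₂, h₂'⟩ := hP (x := 0) (y := 2) (m := 1) (by decide) (by decide) (by decide)
    -- where the colors 0 and 2 agree, color 1 is larger
    have h02 : ∀ p, f 0 p = f 2 p → f 0 p < f 1 p := by
      intro p hp
      by_contra! hle
      obtain ⟨q, δ, hδ, hq⟩ := colorMin_sub_increasing (c := c) hsurj
        (hdisj (x := 0) (y := 2) (by decide))
      obtain ⟨-, hconn, -⟩ := isPreconnected_of_increasing ((hfc 0).sub (hfc 2)) hδ hq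
      obtain ⟨r, hr, hre⟩ := hconn.intermediate_value₂ (a := p₂) (b := p) (sub_eq_zero.2 h₂)
        (sub_eq_zero.2 hp) (hfc 0).continuousOn (hfc 1).continuousOn h₂' hle
      have hr : f 0 r = f 2 r := sub_eq_zero.1 hr
      exact hne r hre (hre.symm.trans hr)
    -- In the connected region `f 1 ≤ f 0`, color 2 is at least color 0 at `p₀` and at most color 0
    -- at `p₁`, so they agree somewhere in it, contrary to `h02`.
    obtain ⟨q, δ, hδ, hq⟩ := colorMin_sub_increasing (c := c) hsurj
      (hdisj (x := 0) (y := 1) (by decide))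
    obtain ⟨-, -, hconn⟩ := isPreconnected_of_increasing ((hfc 0).sub (hfc 1)) hδ hq
    obtain ⟨r, hr, hre⟩ := hconn.intermediate_value₂ (a := p₀) (b := p₁)
      (sub_nonneg.2 h₀.ge) (sub_nonneg.2 h₁')
      (hfc 0).continuousOn (hfc 2).continuousOn h₀' (by linarith)
    have h1 := h02 r hre
    have h2 : 0 ≤ f 0 r - f 1 r := hr
    linarith

end Trichromatic

/-! ### Sides of the edges of a tree -/

section Tree

variable {V : Type*} {G : SimpleGraph V}

/-- The vertices on the side of `w` of the edge `vw`. -/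
def side (G : SimpleGraph V) (v w : V) : Set V :=
  {u | (G.deleteEdges {s(v, w)}).Reachable u w}

theorem self_mem_side (v w : V) : w ∈ side G v w := SimpleGraph.Reachable.refl _

theorem notMem_side_of_mem (hG : G.IsTree) {v w u : V} (h : G.Adj v w) (hu : u ∈ side G v w) :
    u ∉ side G w v := by
  intro hu'
  have hb := SimpleGraph.isAcyclic_iff_forall_adj_isBridge.1 hG.isAcyclic h
  rw [SimpleGraph.isBridge_iff] at hb
  unfold side at hu hu'
  rw [Sym2.eq_swap] at hu'
  have := (SimpleGraph.Reachable.symm hu').trans hu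
  simp_all

theorem notMem_side (hG : G.IsTree) {v w : V} (h : G.Adj v w) : v ∉ side G v w :=
  fun hv => notMem_side_of_mem hG h hv (self_mem_side w v)

theorem adj_mem_side (hG : G.IsTree) {v w u u' : V} (h : G.Adj v w) (hu : u ∈ side G v w)
    (huu : G.Adj u u') (hu' : u' ≠ v) : u' ∈ side G v w := by
  have hadj : (G.deleteEdges {s(v, w)}).Adj u' u := by
    rw [SimpleGraph.deleteEdges_adj]
    refine ⟨huu.symm, fun he => ?_⟩
    rcases Sym2.eq_iff.1 (mem_singleton_iff.1 he) with ⟨h1, -⟩ | ⟨-, h2⟩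
    · exact hu' h1
    · exact notMem_side hG h (h2 ▸ hu)
  exact hadj.reachable.trans hu

theorem walk_mem_side (hG : G.IsTree) {v w u u' : V} (h : G.Adj v w) (hu : u ∈ side G v w)
    (p : G.Walk u u') (hp : v ∉ p.support) : u' ∈ side G v w := by
  induction p with
  | nil => exact hu
  | cons huu p ih =>
    rw [SimpleGraph.Walk.support_cons, List.mem_cons, not_or] at hp
    exact ih (adj_mem_side hG h hu huu fun e => hp.2 (e ▸ p.start_mem_support)) hp.2

theorem mem_side_or (hG : G.IsTree) {v w : V} (h : G.Adj v w) (u : V) :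
    u ∈ side G v w ∨ u ∈ side G w v := by
  obtain ⟨p⟩ := hG.connected.preconnected w u
  have key : ∀ {a b : V} (p : G.Walk a b), a ∈ side G v w ∨ a ∈ side G w v →
      b ∈ side G v w ∨ b ∈ side G w v := by
    intro a b p
    induction p with
    | nil => exact id
    | @cons a a' b haa p ih =>
      intro ha
      apply ih
      rcases ha with ha | ha
      · by_cases e : a' = v
        · exact Or.inr (by rw [e]; exact self_mem_side w v)
        · exact Or.inl (adj_mem_side hG h ha haa e)
      · by_cases e : a' = w
        · exact Or.inl (by rw [e]; exact self_mem_side v w)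
        · exact Or.inr (adj_mem_side hG h.symm ha haa e)
  exact key p (Or.inl (self_mem_side v w))

theorem exists_walk_of_mem_side (hG : G.IsTree) {v w u : V} (h : G.Adj v w)
    (hu : u ∈ side G v w) : ∃ p : G.Walk u w, v ∉ p.support := by
  have key : ∀ {a b : V}, (G.deleteEdges {s(v, w)}).Walk a b → b ∈ side G v w →
      ∃ p : G.Walk a b, v ∉ p.support := by
    intro a b p hb
    induction p with
    | nil =>
      refine ⟨SimpleGraph.Walk.nil, ?_⟩
      rw [SimpleGraph.Walk.support_nil, List.mem_singleton]
      rintro rfl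
      exact notMem_side hG h hb
    | @cons a a' b haa p ih =>
      obtain ⟨p', hp'⟩ := ih hb
      refine ⟨SimpleGraph.Walk.cons (SimpleGraph.deleteEdges_le _ haa) p', ?_⟩
      rw [SimpleGraph.Walk.support_cons, List.mem_cons, not_or]
      refine ⟨?_, hp'⟩
      rintro rfl
      exact notMem_side hG h (haa.reachable.trans (p.reachable.trans hb))
  obtain ⟨p⟩ := hu
  exact key p (self_mem_side v w)

/-- A vertex beyond `w'` reaches `w'` by a walk avoiding `w`. Starting on the side of `v`, such a
walk could never leave that side, whereas `w'` is on the other one. -/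
theorem side_subset (hG : G.IsTree) {v w w' : V} (h : G.Adj v w) (h' : G.Adj w w')
    (hne : w' ≠ v) : side G w w' ⊆ side G v w := by
  intro u hu
  rcases mem_side_or hG h u with h1 | h1
  · exact h1
  · obtain ⟨p, hp⟩ := exists_walk_of_mem_side hG h' hu
    have h2 := walk_mem_side hG h.symm h1 p hp
    exact absurd h2 (notMem_side_of_mem hG h
      (adj_mem_side hG h (self_mem_side v w) h' hne))

theorem exists_mem_side (hG : G.IsTree) {w u : V} (hne : u ≠ w) :
    ∃ w', G.Adj w w' ∧ u ∈ side G w w' := by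
  classical
  obtain ⟨p, hp⟩ := hG.connected.exists_isPath w u
  cases p with
  | nil => exact absurd rfl hne
  | @cons _ w' _ h p =>
    rw [SimpleGraph.Walk.cons_isPath_iff] at hp
    exact ⟨w', h, walk_mem_side hG h (self_mem_side w w') p hp.2⟩

theorem side_unique (hG : G.IsTree) {w w' w'' u : V} (h' : G.Adj w w') (h'' : G.Adj w w'')
    (hu' : u ∈ side G w w') (hu'' : u ∈ side G w w'') : w' = w'' := by
  by_contra hne
  exact notMem_side_of_mem hG h'.symm (side_subset hG h'.symm h'' (Ne.symm hne) hu'') hu'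

theorem exists_child (hG : G.IsTree) {v w u : V} (h : G.Adj v w) (hu : u ∈ side G v w)
    (hne : u ≠ w) : ∃ w', G.Adj w w' ∧ w' ≠ v ∧ u ∈ side G w w' := by
  obtain ⟨w', h', hu'⟩ := exists_mem_side hG hne
  refine ⟨w', h', ?_, hu'⟩
  rintro rfl
  exact notMem_side_of_mem hG h hu hu'

/-- Induction along oriented edges, from the far ends of the tree. -/
theorem dart_induction [Finite V] (hG : G.IsTree) {P : V → V → Prop}
    (hP : ∀ v w, G.Adj v w → (∀ w', G.Adj w w' → w' ≠ v → P w w') → P v w) :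
    ∀ v w, G.Adj v w → P v w := by
  -- The number of vertices beyond the edge drops at each step, since `w` is lost.
  have key : ∀ N v w, G.Adj v w → (side G v w).ncard = N → P v w := by
    intro N
    induction N using Nat.strong_induction_on with
    | _ N ih =>
      rintro v w h rfl
      refine hP v w h fun w' h' hne => ih _ ?_ w w' h' rfl
      refine Set.ncard_lt_ncard ?_ (Set.toFinite _)
      exact ⟨side_subset hG h h' hne, fun hs => notMem_side hG h' (hs (self_mem_side v w))⟩
  exact fun v w h => key _ v w h rfl

end Tree

/-! ### Branches at a vertex and positions of the other vertices -/

section Branches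

variable {n : ℕ} {V : Type*} [Finite V] (L : TropicalLine n V)

theorem mem_leavesBeyond {v w : V} {i : Fin n} :
    i ∈ leavesBeyond L.graph L.leaf v w ↔ L.leaf i ∈ side L.graph v w := Iff.rfl

/-- The edges at a vertex, unbounded or bounded. -/
abbrev Branch (v : V) : Type _ := {i : Fin n // L.leaf i = v} ⊕ {w : V // L.graph.Adj v w}

open Classical in
/-- The edge at `v` in whose direction the leaf `i` lies. -/
noncomputable def branchOf (v : V) (i : Fin n) : Branch L v :=
  if h : L.leaf i = v then Sum.inl ⟨i, h⟩
  else Sum.inr ⟨(exists_mem_side L.isTree h).choose, (exists_mem_side L.isTree h).choose_spec.1⟩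

variable {L}

theorem branchOf_eq_inr {v : V} {i : Fin n} {w : {w : V // L.graph.Adj v w}} :
    branchOf L v i = Sum.inr w ↔ i ∈ leavesBeyond L.graph L.leaf v w := by
  unfold branchOf
  split_ifs with h
  · simp only [false_iff, mem_leavesBeyond, h]
    exact notMem_side L.isTree w.2
  · have hs := (exists_mem_side L.isTree h).choose_spec
    rw [Sum.inr.injEq, mem_leavesBeyond]
    constructor
    · rintro rfl
      exact hs.2
    · intro hi
      exact Subtype.ext (side_unique L.isTree hs.1 w.2 hs.2 hi)

theorem branchOf_eq_inl {v : V} {i : Fin n} {j : {i : Fin n // L.leaf i = v}} :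
    branchOf L v i = Sum.inl j ↔ i = j := by
  unfold branchOf
  split_ifs with h
  · rw [Sum.inl.injEq, Subtype.ext_iff]
  · simp only [false_iff]
    rintro rfl
    exact h j.2

/-- A vertex without leaves has at least three neighbors, so the search for a leaf can move on, away
from `v`, until it ends. -/
theorem exists_leaf_beyond : ∀ v w, L.graph.Adj v w →
    (leavesBeyond L.graph L.leaf v w).Nonempty := by
  refine dart_induction L.isTree fun v w h ih => ?_
  by_cases hl : ∃ i, L.leaf i = w
  · obtain ⟨i, rfl⟩ := hl
    exact ⟨i, self_mem_side v _⟩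
  · have h3 := L.three_le_valence w
    have h0 : {i | L.leaf i = w} = ∅ := by
      ext i
      simpa using fun h => hl ⟨i, h⟩
    rw [h0, Set.ncard_empty, add_zero] at h3
    obtain ⟨w', hw', hne⟩ := Set.exists_ne_of_one_lt_ncard (a := v) (by omega :
      1 < (L.graph.neighborSet w).ncard)
    obtain ⟨i, hi⟩ := ih w' hw' hne
    exact ⟨i, side_subset L.isTree h hw' hne hi⟩

theorem branchOf_surjective (v : V) : Function.Surjective (branchOf L v) := by
  rintro (j | w)
  · exact ⟨j, branchOf_eq_inl.2 rfl⟩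
  · obtain ⟨i, hi⟩ := exists_leaf_beyond v w w.2
    exact ⟨i, branchOf_eq_inr.2 hi⟩

theorem card_branch (htri : L.IsTrivalent) (v : V) : Nat.card (Branch L v) = 3 := by
  rw [Nat.card_sum, ← htri v, TropicalLine.valence, add_comm]
  rfl

theorem nonempty_branch (htri : L.IsTrivalent) (v : V) : Nonempty (Branch L v) :=
  (Nat.card_pos_iff.1 (by rw [card_branch htri v]; norm_num)).1

theorem separates_of_branchOf_ne {v : V} {i j : Fin n} (h : branchOf L v i ≠ branchOf L v j) :
    L.Separates v i j := by
  refine ⟨fun e => h (e ▸ rfl), fun p => ?_⟩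
  by_contra hp
  have hi : L.leaf i ≠ v := fun e => hp (e ▸ p.start_mem_support)
  obtain ⟨w, hw, hiw⟩ := exists_mem_side L.isTree hi
  have hjw := walk_mem_side L.isTree hw hiw p hp
  exact h ((branchOf_eq_inr (w := ⟨w, hw⟩).2 hiw).trans (branchOf_eq_inr (w := ⟨w, hw⟩).2 hjw).symm)

/-- A branch with two leaves is a bounded edge, and it separates these leaves from the other
branches. This turns compatibility of `L` into compatibility of the coloring at `v`. -/
theorem isQuartet_of_branchOf {v : V} {i i' j k : Fin n} (hii : i ≠ i') (hjk : j ≠ k)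
    (h : branchOf L v i = branchOf L v i') (hj : branchOf L v j ≠ branchOf L v i)
    (hk : branchOf L v k ≠ branchOf L v i) : L.IsQuartet i i' j k := by
  rcases e : branchOf L v i with l | w
  · exact absurd ((branchOf_eq_inl.1 e).trans (branchOf_eq_inl.1 (h ▸ e)).symm) hii
  · have key : ∀ l, branchOf L v l ≠ branchOf L v i → l ∈ leavesBeyond L.graph L.leaf w v := by
      intro l hl
      rcases mem_side_or L.isTree w.2 (L.leaf l) with h1 | h1
      · exact absurd ((branchOf_eq_inr.2 h1).trans e.symm) hl
      · exact h1
    exact ⟨hii, hjk, w, v, w.2.symm, branchOf_eq_inr.1 e, branchOf_eq_inr.1 (h ▸ e), key j hj,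
      key k hk⟩

theorem mk_add (x y : Fin n → ℝ) : TP.mk (x + y) = TP.mk x + TP.mk y := rfl

theorem mk_smul (t : ℝ) (x : Fin n → ℝ) : TP.mk (t • x) = t • TP.mk x := rfl

theorem mk_eq_mk {x y : Fin n → ℝ} : TP.mk x = TP.mk y ↔ ∃ t : ℝ, ∀ i, x i = y i + t := by
  unfold TP.mk
  rw [Submodule.Quotient.eq, Submodule.mem_span_singleton]
  constructor
  · rintro ⟨t, ht⟩
    refine ⟨t, fun i => ?_⟩
    have := congrFun ht i
    simp at this
    linarith
  · rintro ⟨t, ht⟩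
    refine ⟨t, ?_⟩
    ext i
    simp [ht i]

theorem exists_mk (x : TP n) : ∃ c : Fin n → ℝ, TP.mk c = x := Submodule.Quotient.mk_surjective _ x

variable (L)

/-- The point `x` lies beyond the branch `y` of the vertex `u`: it is obtained from the position of
`u` by increasing exactly the coordinates of the leaves of that branch. -/
def Toward (x : TP n) (u : V) (y : Branch L u) : Prop :=
  ∃ ξ : Fin n → ℝ, x = L.pos u + TP.mk ξ ∧ (∀ i, branchOf L u i = y → 0 < ξ i) ∧
    ∀ i, branchOf L u i ≠ y → ξ i = 0

variable {L}

/-- The first edge raises all leaves beyond it by a positive amount. Sides are nested, so later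
edges raise only leaves that are already among these. -/
theorem pos_toward : ∀ v w (h : L.graph.Adj v w), ∀ u ∈ side L.graph v w,
    Toward L (L.pos u) v (Sum.inr ⟨w, h⟩) := by
  intro v w h
  refine dart_induction L.isTree (P := fun v w => ∀ h : L.graph.Adj v w,
    ∀ u ∈ side L.graph v w, Toward L (L.pos u) v (Sum.inr ⟨w, h⟩)) ?_ v w h h
  clear h v w
  intro v w _ ih h u hu
  obtain ⟨t, ht, hpos⟩ := L.direction v w h
  have hbase : ∀ i, branchOf L v i = Sum.inr ⟨w, h⟩ →
      (leavesBeyond L.graph L.leaf v w).indicator (fun _ => (1 : ℝ)) i = 1 :=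
    fun i hi => Set.indicator_of_mem (branchOf_eq_inr.1 hi) _
  have hbase' : ∀ i, branchOf L v i ≠ Sum.inr ⟨w, h⟩ →
      (leavesBeyond L.graph L.leaf v w).indicator (fun _ => (1 : ℝ)) i = 0 :=
    fun i hi => Set.indicator_of_notMem (fun h' => hi (branchOf_eq_inr.2 h')) _
  by_cases huw : u = w
  · subst huw
    refine ⟨t • (leavesBeyond L.graph L.leaf v u).indicator fun _ => 1, hpos, fun i hi => ?_,
      fun i hi => ?_⟩
    · simp only [Pi.smul_apply, hbase i hi, smul_eq_mul, mul_one, ht]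
    · simp only [Pi.smul_apply, hbase' i hi, smul_zero]
  · obtain ⟨w', hw', hne, huw'⟩ := exists_child L.isTree h hu huw
    obtain ⟨ξ, hξ, hξ1, hξ0⟩ := ih w' hw' hne hw' u huw'
    have hξ' : ∀ i, 0 ≤ ξ i := by
      intro i
      by_cases hi : branchOf L w i = Sum.inr ⟨w', hw'⟩
      · exact (hξ1 i hi).le
      · exact (hξ0 i hi).ge
    refine ⟨t • (leavesBeyond L.graph L.leaf v w).indicator (fun _ => 1) + ξ, ?_, fun i hi => ?_,
      fun i hi => ?_⟩
    · rw [mk_add, mk_smul, ← add_assoc, ← hpos, hξ]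
    · simp only [Pi.add_apply, Pi.smul_apply, hbase i hi, smul_eq_mul, mul_one]
      linarith [hξ' i]
    · simp only [Pi.add_apply, Pi.smul_apply, hbase' i hi, smul_zero, zero_add]
      refine hξ0 i fun hi' => hi (branchOf_eq_inr.2 ?_)
      exact side_subset L.isTree h hw' hne (branchOf_eq_inr.1 hi')

variable (L) in
/-- The weak form of `Toward`, which includes the position of the vertex itself. -/
def WeaklyToward (x : TP n) (u : V) (y : Branch L u) : Prop :=
  ∃ ξ : Fin n → ℝ, x = L.pos u + TP.mk ξ ∧ (∀ i, 0 ≤ ξ i) ∧ ∀ i, branchOf L u i ≠ y → ξ i = 0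

theorem Toward.weaklyToward {x : TP n} {u : V} {y : Branch L u} (h : Toward L x u y) :
    WeaklyToward L x u y := by
  obtain ⟨ξ, hx, h1, h0⟩ := h
  refine ⟨ξ, hx, fun i => ?_, h0⟩
  by_cases hi : branchOf L u i = y
  · exact (h1 i hi).le
  · exact (h0 i hi).ge

theorem weaklyToward_self (u : V) (y : Branch L u) : WeaklyToward L (L.pos u) u y :=
  ⟨0, by rw [show TP.mk (0 : Fin n → ℝ) = 0 from rfl, add_zero], fun _ => le_rfl, fun _ _ => rfl⟩

theorem combine_eq (x ξ η : Fin n → ℝ) {α β : ℝ} (hαβ : α + β = 1) :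
    α • (TP.mk x + TP.mk ξ) + β • (TP.mk x + TP.mk η) = TP.mk x + TP.mk (α • ξ + β • η) := by
  rw [mk_add (α • ξ), mk_smul, mk_smul]
  have : α • (TP.mk x + TP.mk ξ) + β • (TP.mk x + TP.mk η) =
      (α + β) • TP.mk x + (α • TP.mk ξ + β • TP.mk η) := by module
  rw [this, hαβ, one_smul]

theorem WeaklyToward.combine {x y : TP n} {u : V} {z : Branch L u} (hx : WeaklyToward L x u z)
    (hy : WeaklyToward L y u z) {α β : ℝ} (hα : 0 ≤ α) (hβ : 0 ≤ β) (hαβ : α + β = 1) :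
    WeaklyToward L (α • x + β • y) u z := by
  obtain ⟨ξ, rfl, h1, h0⟩ := hx
  obtain ⟨η, rfl, k1, k0⟩ := hy
  obtain ⟨c, hc⟩ := exists_mk (L.pos u)
  refine ⟨α • ξ + β • η, by rw [← hc, combine_eq _ _ _ hαβ], fun i => ?_, fun i hi => ?_⟩
  · have := h1 i
    have := k1 i
    simp only [Pi.add_apply, Pi.smul_apply, smul_eq_mul]
    positivity
  · simp [h0 i hi, k0 i hi]

theorem Toward.combine {x y : TP n} {u : V} {z : Branch L u} (hx : Toward L x u z)
    (hy : WeaklyToward L y u z) {α β : ℝ} (hα : 0 < α) (hβ : 0 ≤ β) (hαβ : α + β = 1) :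
    Toward L (α • x + β • y) u z := by
  obtain ⟨ξ, rfl, h1, h0⟩ := hx
  obtain ⟨η, rfl, k1, k0⟩ := hy
  obtain ⟨c, hc⟩ := exists_mk (L.pos u)
  refine ⟨α • ξ + β • η, by rw [← hc, combine_eq _ _ _ hαβ], fun i hi => ?_, fun i hi => ?_⟩
  · have := h1 i hi
    have := k1 i
    simp only [Pi.add_apply, Pi.smul_apply, smul_eq_mul]
    positivity
  · simp [h0 i hi, k0 i hi]

theorem pos_weaklyToward {v w : V} (h : L.graph.Adj v w) {u : V} (hu : u = v ∨ u ∈ side L.graph v w) :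
    WeaklyToward L (L.pos u) v (Sum.inr ⟨w, h⟩) := by
  rcases hu with rfl | hu
  · exact weaklyToward_self _ _
  · exact (pos_toward v w h u hu).weaklyToward

theorem pos_leaf_weaklyToward (i : Fin n) (u : V) :
    WeaklyToward L (L.pos (L.leaf i)) u (branchOf L u i) := by
  rcases e : branchOf L u i with j | w
  · have hi : L.leaf i = u := by rw [branchOf_eq_inl.1 e]; exact j.2
    rw [hi]
    exact weaklyToward_self _ _
  · exact pos_weaklyToward w.2 (Or.inr (branchOf_eq_inr.1 e))

theorem eq_or_eq_or_eq (htri : L.IsTrivalent) {v : V} {x y z : Branch L v} (hxy : x ≠ y)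
    (hxz : x ≠ z) (hyz : y ≠ z) (t : Branch L v) : t = x ∨ t = y ∨ t = z := by
  let e := Finite.equivFinOfCardEq (card_branch htri v)
  have h1 := e.injective.ne hxy
  have h2 := e.injective.ne hxz
  have h3 := e.injective.ne hyz
  have : e t = e x ∨ e t = e y ∨ e t = e z := by omega
  simpa using this

theorem exists_two_other (htri : L.IsTrivalent) {v : V} (x : Branch L v) :
    ∃ y z, x ≠ y ∧ x ≠ z ∧ y ≠ z := by
  let e := Finite.equivFinOfCardEq (card_branch htri v)
  refine ⟨e.symm (e x + 1), e.symm (e x + 2), fun h => ?_, fun h => ?_, fun h => ?_⟩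
  · have := congrArg e h
    rw [Equiv.apply_symm_apply] at this
    omega
  · have := congrArg e h
    rw [Equiv.apply_symm_apply] at this
    omega
  · have := e.symm.injective h
    omega

/-- The number of vertices of a trivalent tropical line. -/
theorem card_vertices (htri : L.IsTrivalent) : n = Nat.card V + 2 := by
  classical
  have : Fintype V := Fintype.ofFinite V
  -- Counting edge ends: `2 (|V| - 1) + n = 3 |V|`.
  have h1 := L.graph.sum_degrees_eq_twice_card_edges
  have h2 := L.isTree.card_edgeFinset
  have h3 : ∀ v, L.graph.degree v + (Finset.univ.filter fun i => L.leaf i = v).card = 3 := by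
    intro v
    rw [← htri v, TropicalLine.valence, ← SimpleGraph.card_neighborSet_eq_degree,
      ← Nat.card_coe_set_eq, Nat.card_eq_fintype_card, ← Set.ncard_coe_finset]
    simp
  have h4 : ∑ v, (L.graph.degree v + (Finset.univ.filter fun i => L.leaf i = v).card) =
      3 * Fintype.card V := by
    simp [h3, mul_comm]
  have h5 := Finset.card_eq_sum_card_fiberwise (f := L.leaf) (s := Finset.univ)
    (t := Finset.univ) fun _ _ => Finset.mem_univ _
  rw [Finset.card_univ, Fintype.card_fin] at h5
  rw [Finset.sum_add_distrib, ← h5] at h4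
  rw [Nat.card_eq_fintype_card]
  omega

end Branches

/-! ### The pencil of curves through the vertex points -/

section Pencil

variable {n d : ℕ} {V : Type*} [Finite V] {a : Fin n → Fin 3 → ℕ} {L : TropicalLine n V}

theorem tropTerm_add_const {c c' : Fin n → ℝ} {t : ℝ} (h : ∀ i, c i = c' i + t) (p : Fin 3 → ℝ)
    (i : Fin n) : tropTerm a c p i = tropTerm a c' p i + t := by
  unfold tropTerm
  rw [h i]
  ring

theorem minTerms_congr {c c' : Fin n → ℝ} (h : TP.mk c = TP.mk c') (p : Fin 3 → ℝ) :
    minTerms a c p = minTerms a c' p := by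
  obtain ⟨t, ht⟩ := mk_eq_mk.1 h
  ext i
  simp [minTerms, tropTerm_add_const ht]

theorem tropTerm_point_add_const (hd : ∀ i, ∑ m, a i m = d) {c : Fin n → ℝ} {p p' : Fin 3 → ℝ}
    {t : ℝ} (h : ∀ m, p m = p' m + t) (i : Fin n) :
    tropTerm a c p i = tropTerm a c p' i + d * t := by
  unfold tropTerm
  have : (d : ℝ) = ∑ m, (a i m : ℝ) := by rw [← hd i]; push_cast; rfl
  rw [this, Finset.sum_mul, add_assoc, ← Finset.sum_add_distrib]
  congr 1
  refine Finset.sum_congr rfl fun m _ => ?_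
  rw [h m]
  ring

theorem minTerms_point_congr (hd : ∀ i, ∑ m, a i m = d) (c : Fin n → ℝ) {p p' : Fin 3 → ℝ}
    (h : TP.mk p = TP.mk p') : minTerms a c p = minTerms a c p' := by
  obtain ⟨t, ht⟩ := mk_eq_mk.1 h
  ext i
  simp [minTerms, tropTerm_point_add_const hd ht]

theorem mem_tropCurve_iff (hd : ∀ i, ∑ m, a i m = d) {S : Set (Fin n)} {c : Fin n → ℝ}
    {p : Fin 3 → ℝ} : TP.mk p ∈ tropCurve a S c ↔ ∃ i ∈ S, ∃ j ∈ S, i ≠ j ∧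
      tropTerm a c p i = tropTerm a c p j ∧ ∀ l ∈ S, tropTerm a c p i ≤ tropTerm a c p l := by
  constructor
  · rintro ⟨p', ⟨i, hi, j, hj, hij, h1, h2⟩, he⟩
    obtain ⟨t, ht⟩ := mk_eq_mk.1 he
    simp only [tropTerm_point_add_const hd ht] at h1 h2
    exact ⟨i, hi, j, hj, hij, by linarith, fun l hl => by linarith [h2 l hl]⟩
  · intro h
    exact ⟨p, h, rfl⟩

theorem mem_tropCurve_univ_iff (hd : ∀ i, ∑ m, a i m = d) {c : Fin n → ℝ} {p : Fin 3 → ℝ} :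
    TP.mk p ∈ tropCurve a univ c ↔
      ∃ i ∈ minTerms a c p, ∃ j ∈ minTerms a c p, i ≠ j := by
  rw [mem_tropCurve_iff hd]
  constructor
  · rintro ⟨i, -, j, -, hij, h1, h2⟩
    exact ⟨i, fun l => h2 l trivial, j, fun l => h1 ▸ h2 l trivial, hij⟩
  · rintro ⟨i, hi, j, hj, hij⟩
    exact ⟨i, trivial, j, trivial, hij, le_antisymm (hi j) (hj i), fun l _ => hi l⟩

variable (a L) in
/-- A point of the plane for every vertex of the line, at which the minimum is attained exactly by
one leaf in every branch at the vertex. -/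
structure VertexPoints where
  /-- a lift of the position of the vertex -/
  weight : V → Fin n → ℝ
  mk_weight : ∀ v, TP.mk (weight v) = L.pos v
  /-- a lift of the point -/
  point : V → Fin 3 → ℝ
  /-- the minimal term in the given branch -/
  term : ∀ v, Branch L v → Fin n
  branchOf_term : ∀ v x, branchOf L v (term v x) = x
  minTerms_eq : ∀ v, minTerms a (weight v) (point v) = range (term v)

namespace VertexPoints

variable (C : VertexPoints a L)

theorem term_injective (v : V) : Function.Injective (C.term v) :=
  Function.LeftInverse.injective (C.branchOf_term v)

/-- Going into branch `y` only raises terms of that branch, so minimal terms elsewhere stay minimal.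
-/
theorem term_mem_minTerms {x : Fin n → ℝ} {u : V} {y : Branch L u}
    (h : WeaklyToward L (TP.mk x) u y) {z : Branch L u} (hz : z ≠ y) :
    C.term u z ∈ minTerms a x (C.point u) := by
  obtain ⟨ξ, hx, h0, h1⟩ := h
  rw [← C.mk_weight u, ← mk_add] at hx
  rw [minTerms_congr hx]
  intro l
  have hmem : C.term u z ∈ minTerms a (C.weight u) (C.point u) := by
    rw [C.minTerms_eq]
    exact mem_range_self z
  have := hmem l
  have e : ξ (C.term u z) = 0 := h1 _ (by rwa [C.branchOf_term])
  have := h0 l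
  simp only [tropTerm, Pi.add_apply] at *
  linarith

/-- When the raise in branch `y` is strict, its term drops out and exactly the other two remain. -/
theorem mem_minTerms_iff (htri : L.IsTrivalent) {x : Fin n → ℝ} {u : V} {y : Branch L u}
    (h : Toward L (TP.mk x) u y) {i : Fin n} :
    i ∈ minTerms a x (C.point u) ↔ ∃ z, z ≠ y ∧ C.term u z = i := by
  constructor
  · intro hi
    obtain ⟨z, -, hz, -, -⟩ := exists_two_other htri y
    have hzm := C.term_mem_minTerms h.weaklyToward hz.symm
    obtain ⟨ξ, hx, h1, h0⟩ := h
    rw [← C.mk_weight u, ← mk_add] at hx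
    rw [minTerms_congr hx] at hi hzm
    have hzw : C.term u z ∈ minTerms a (C.weight u) (C.point u) := by
      rw [C.minTerms_eq]
      exact mem_range_self z
    have e : ξ (C.term u z) = 0 := h0 _ (by rw [C.branchOf_term]; exact hz.symm)
    have k1 := hi (C.term u z)
    have k2 := hzw i
    simp only [tropTerm, Pi.add_apply] at k1 k2
    have hiy : branchOf L u i ≠ y := by
      intro hiy
      have := h1 i hiy
      linarith
    have hiw : i ∈ minTerms a (C.weight u) (C.point u) := by
      intro l
      have k3 := hzw l
      have := h0 i hiy
      simp only [tropTerm] at *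
      linarith
    rw [C.minTerms_eq] at hiw
    obtain ⟨z', rfl⟩ := hiw
    rw [C.branchOf_term] at hiy
    exact ⟨z', hiy, rfl⟩
  · rintro ⟨z, hz, rfl⟩
    exact C.term_mem_minTerms h.weaklyToward hz

end VertexPoints

/-- The indices at which the difference `c - x` is minimal. -/
def minDiff (x c : Fin n → ℝ) : Set (Fin n) := {i | ∀ l, c i - x i ≤ c l - x l}

theorem minDiff_eq {x c : Fin n → ℝ} {i j : Fin n} (hi : i ∈ minDiff x c) (hj : j ∈ minDiff x c) :
    c i - x i = c j - x j := le_antisymm (hi j) (hj i)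

theorem mk_eq_of_minDiff_eq_univ {x c : Fin n → ℝ} (h : ∀ i, i ∈ minDiff x c) :
    TP.mk c = TP.mk x := by
  rcases isEmpty_or_nonempty (Fin n) with hn | ⟨⟨i⟩⟩
  · exact congrArg TP.mk (Subsingleton.elim _ _)
  · refine mk_eq_mk.2 ⟨c i - x i, fun j => ?_⟩
    have := minDiff_eq (h i) (h j)
    linarith

/-- If the minimum of the curve `c` at `p` is attained twice, then a minimal index of `x` at `p`
where `c - x` is also minimal is not the only one. -/
theorem exists_ne_mem_minDiff {x c : Fin n → ℝ} {p : Fin 3 → ℝ}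
    (hc : ∃ i ∈ minTerms a c p, ∃ j ∈ minTerms a c p, i ≠ j) {i : Fin n}
    (hi : i ∈ minDiff x c) (hi' : i ∈ minTerms a x p) :
    ∃ j, j ≠ i ∧ j ∈ minDiff x c ∧ j ∈ minTerms a x p := by
  -- A term of `c` is the sum of `c - x` and the term of `x`. Both summands are minimal at `i`, so
  -- any minimizer of the sum minimizes both.
  have key : ∀ k ∈ minTerms a c p, k ∈ minDiff x c ∧ k ∈ minTerms a x p := by
    intro k hk
    have h1 := hk i
    have h2 := hi k
    have h3 := hi' k
    simp only [tropTerm] at h1 h3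
    constructor
    · intro l
      have := hi l
      linarith
    · intro l
      have := hi' l
      simp only [tropTerm] at *
      linarith
  obtain ⟨j, hj, k, hk, hjk⟩ := hc
  by_cases hji : j = i
  · exact ⟨k, fun h => hjk (hji.trans h.symm), key k hk⟩
  · exact ⟨j, hji, key j hj⟩

theorem pos_mem_carrier (htri : L.IsTrivalent) (v : V) : L.pos v ∈ L.carrier := by
  obtain ⟨⟨i, rfl⟩ | ⟨w, hw⟩⟩ := nonempty_branch htri v
  · exact Or.inr ⟨i, 0, le_rfl, by simp⟩
  · exact Or.inl ⟨v, w, hw, left_mem_segment ℝ _ _⟩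

namespace VertexPoints

variable (C : VertexPoints a L)

/-- The curve with coefficients `c` contains all points of the system. -/
def OnAll (c : Fin n → ℝ) : Prop :=
  ∀ u, ∃ i ∈ minTerms a c (C.point u), ∃ j ∈ minTerms a c (C.point u), i ≠ j

variable {C}

/-- The set where `c - x` is minimal contains the leaves beyond an edge all or none, provided that
`x` lies on the near side. -/
theorem OnAll.minDiff_beyond (htri : L.IsTrivalent) {x c : Fin n → ℝ} (hc : C.OnAll c) :
    ∀ v w, L.graph.Adj v w → (∀ u ∈ side L.graph v w, ∀ y, ∀ hy : L.graph.Adj u y,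
      v ∈ side L.graph u y → Toward L (TP.mk x) u (Sum.inr ⟨y, hy⟩)) →
      ∀ i ∈ leavesBeyond L.graph L.leaf v w, ∀ j ∈ leavesBeyond L.graph L.leaf v w,
        i ∈ minDiff x c → j ∈ minDiff x c := by
  refine dart_induction L.isTree fun v w h ih hx i hi j hj hiM => ?_
  set z₀ : Branch L w := Sum.inr ⟨v, h.symm⟩ with hz₀
  have hw := hx w (self_mem_side v w) v h.symm (self_mem_side w v)
  have hbr : ∀ k ∈ leavesBeyond L.graph L.leaf v w, branchOf L w k ≠ z₀ := fun k hk he =>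
    notMem_side_of_mem L.isTree h hk (branchOf_eq_inr.1 he)
  -- By induction, the minimal set contains all or nothing of each branch at `w` pointing away from
  -- `v`.
  have hsat : ∀ k l, branchOf L w k ≠ z₀ → branchOf L w k = branchOf L w l →
      k ∈ minDiff x c → l ∈ minDiff x c := by
    intro k l hk hkl hkM
    rcases e : branchOf L w k with r | ⟨w', hw'⟩
    · have hlk : l = k :=
        (branchOf_eq_inl.1 (hkl.symm.trans e)).trans (branchOf_eq_inl.1 e).symm
      rwa [hlk]
    · have hne : w' ≠ v := by
        rintro rfl
        exact hk e
      refine ih w' hw' hne (fun u hu y hy hwy => ?_) k (branchOf_eq_inr.1 e) l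
        (branchOf_eq_inr.1 (hkl.symm.trans e)) hkM
      have huv := side_subset L.isTree h hw' hne hu
      refine hx u huv y hy (adj_mem_side L.isTree hy hwy h.symm ?_)
      rintro rfl
      exact notMem_side L.isTree h huv
  by_cases hij : branchOf L w i = branchOf L w j
  · exact hsat i j (hbr i hi) hij hiM
  -- At the point of `w` just two terms of `x` are minimal, one in each far branch. If one is in the
  -- minimal set, the curve condition for `c` puts the other there too.
  have h1 : C.term w (branchOf L w i) ∈ minDiff x c :=
    hsat i _ (hbr i hi) (C.branchOf_term _ _).symm hiM
  have h2 := (C.mem_minTerms_iff htri hw).2 ⟨_, hbr i hi, rfl⟩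
  obtain ⟨k, hk, hkM, hkm⟩ := exists_ne_mem_minDiff (hc w) h1 h2
  obtain ⟨z, hz, rfl⟩ := (C.mem_minTerms_iff htri hw).1 hkm
  have hzi : z ≠ branchOf L w i := fun e => hk (e ▸ rfl)
  have hzj : z = branchOf L w j := by
    rcases eq_or_eq_or_eq htri (hbr i hi).symm (hbr j hj).symm hij z with e | e | e
    · exact absurd e hz
    · exact absurd e hzi
    · exact e
  exact hsat _ j (by rwa [C.branchOf_term]) (by rw [C.branchOf_term, hzj]) hkM

/-- At a vertex, the set where `c - x` is minimal is everything or the complement of a branch. -/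
theorem OnAll.minDiff_vertex (htri : L.IsTrivalent) {c : Fin n → ℝ} (hc : C.OnAll c) (v : V) :
    (∀ i, i ∈ minDiff (C.weight v) c) ∨
      ∃ x, ∀ i, i ∈ minDiff (C.weight v) c ↔ branchOf L v i ≠ x := by
  set M := minDiff (C.weight v) c with hM
  have hsat : ∀ i j, branchOf L v i = branchOf L v j → i ∈ M → j ∈ M := by
    intro i j hij hi
    rcases e : branchOf L v i with r | ⟨w, hw⟩
    · have hji : j = i :=
        (branchOf_eq_inl.1 (hij.symm.trans e)).trans (branchOf_eq_inl.1 e).symm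
      rwa [hji]
    · refine hc.minDiff_beyond htri v w hw (fun u hu y hy hv => ?_) i (branchOf_eq_inr.1 e) j
        (branchOf_eq_inr.1 (hij.symm.trans e)) hi
      rw [C.mk_weight]
      exact pos_toward u y hy v hv
  have hterm : ∀ x, C.term v x ∈ M → ∀ i, branchOf L v i = x → i ∈ M := fun x hx i hi =>
    hsat _ i (by rw [C.branchOf_term, hi]) hx
  have hn : Nonempty (Fin n) := by
    have := card_vertices htri
    exact ⟨⟨0, by omega⟩⟩
  obtain ⟨i, hi⟩ : M.Nonempty := Finite.exists_min fun l => c l - C.weight v l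
  have hmem : ∀ x, C.term v x ∈ minTerms a (C.weight v) (C.point v) := fun x => by
    rw [C.minTerms_eq]
    exact mem_range_self x
  have h1 : C.term v (branchOf L v i) ∈ M := hsat i _ (C.branchOf_term _ _).symm hi
  -- Among the three minimal terms at the point of `v`, a second one must lie in `M`, so at most one
  -- branch is missing from `M`.
  obtain ⟨j, hj, hjM, hjm⟩ := exists_ne_mem_minDiff (hc v) h1 (hmem _)
  rw [C.minTerms_eq] at hjm
  obtain ⟨y, rfl⟩ := hjm
  have hyx : branchOf L v i ≠ y := fun e => hj (e ▸ rfl)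
  obtain ⟨z, hz1, hz2⟩ : ∃ z, branchOf L v i ≠ z ∧ y ≠ z := by
    obtain ⟨z, z', k1, k2, k3⟩ := exists_two_other htri (branchOf L v i)
    by_cases e : y = z
    · exact ⟨z', k2, e ▸ k3⟩
    · exact ⟨z, k1, e⟩
  have hall := eq_or_eq_or_eq htri hyx hz1 hz2
  by_cases hzM : C.term v z ∈ M
  · left
    intro k
    rcases hall (branchOf L v k) with e | e | e
    · exact hterm _ h1 k e
    · exact hterm _ hjM k e
    · exact hterm _ hzM k e
  · right
    refine ⟨z, fun k => ⟨fun hk e => hzM (hsat k _ (by rw [C.branchOf_term, e]) hk), fun hk => ?_⟩⟩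
    rcases hall (branchOf L v k) with e | e | e
    · exact hterm _ h1 k e
    · exact hterm _ hjM k e
    · exact absurd e hk

theorem mem_carrier_of_ray {c : Fin n → ℝ} {v : V} {j : {i : Fin n // L.leaf i = v}}
    (h : ∀ i, i ∈ minDiff (C.weight v) c ↔ branchOf L v i ≠ Sum.inl j) (htri : L.IsTrivalent) :
    TP.mk c ∈ L.carrier := by
  obtain ⟨z, -, hz, -, -⟩ := exists_two_other htri (Sum.inl j : Branch L v)
  have hzM := (h (C.term v z)).2 (by rw [C.branchOf_term]; exact hz.symm)
  set m := c (C.term v z) - C.weight v (C.term v z) with hm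
  refine Or.inr ⟨j, c j - C.weight v j - m, by linarith [hzM j], ?_⟩
  rw [j.2, ← C.mk_weight, ← mk_smul, ← mk_add, mk_eq_mk]
  refine ⟨m, fun i => ?_⟩
  by_cases hij : i = j
  · subst hij
    simp only [Pi.add_apply, Pi.smul_apply, Pi.single_eq_same, smul_eq_mul, mul_one]
    ring
  · have hi := (h i).2 fun e => hij (branchOf_eq_inl.1 e)
    have := minDiff_eq hi hzM
    simp only [Pi.add_apply, Pi.smul_apply, Pi.single_eq_of_ne hij, smul_zero]
    linarith

/-- The curve `c` exceeds `v` only beyond the edge `vw`. It is either a point in the interior of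
that edge, or it is reached by passing on to `w`. -/
theorem OnAll.mem_carrier_of_beyond (htri : L.IsTrivalent) {c : Fin n → ℝ} (hc : C.OnAll c) :
    ∀ v w (h : L.graph.Adj v w), (∀ i, i ∈ minDiff (C.weight v) c ↔
      branchOf L v i ≠ Sum.inr ⟨w, h⟩) → TP.mk c ∈ L.carrier := by
  intro v w h
  refine dart_induction L.isTree (P := fun v w => ∀ h : L.graph.Adj v w,
    (∀ i, i ∈ minDiff (C.weight v) c ↔ branchOf L v i ≠ Sum.inr ⟨w, h⟩) →
      TP.mk c ∈ L.carrier) ?_ v w h h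
  clear h v w
  intro v w _ ih h hM
  obtain ⟨t, ht, hpos⟩ := L.direction v w h
  set I := leavesBeyond L.graph L.leaf v w with hI
  have hMI : ∀ i, i ∈ minDiff (C.weight v) c ↔ i ∉ I := fun i => by
    rw [hM i, Ne, branchOf_eq_inr]
  obtain ⟨i₁, hi₁, hmin⟩ := Set.exists_min_image I (fun i => c i - C.weight v i) (Set.toFinite _)
    (exists_leaf_beyond v w h)
  obtain ⟨i₀, hi₀⟩ := exists_leaf_beyond w v h.symm
  have hi₀I : i₀ ∉ I := fun h' => notMem_side_of_mem L.isTree h h' hi₀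
  have hi₀M := (hMI i₀).2 hi₀I
  set m := c i₀ - C.weight v i₀ with hm
  have hout : ∀ i, i ∉ I → c i - C.weight v i = m := fun i hi => minDiff_eq ((hMI i).2 hi) hi₀M
  -- The least excess beyond the edge. At distance `s` from `v` the minimal set acquires a leaf on
  -- the far side; if `s < t`, this happens before `w`, and then all far leaves are minimal.
  set s := c i₁ - C.weight v i₁ - m with hs
  have hspos : 0 < s := by
    by_contra! hle
    refine (hMI i₁).1 (fun l => ?_) hi₁
    have := hi₀M l
    linarith
  by_cases hst : s < t
  · -- the curve coincides with an interior point of the edge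
    set x : Fin n → ℝ := C.weight v + s • I.indicator fun _ => 1 with hx
    have hseg : TP.mk x = (1 - s / t) • L.pos v + (s / t) • L.pos w := by
      rw [hx, mk_add, mk_smul, C.mk_weight, hpos, smul_add, smul_smul, div_mul_cancel₀ _ ht.ne']
      module
    have hr0 : 0 < s / t := by positivity
    have hr1 : s / t < 1 := (div_lt_one ht).2 hst
    have hfar : ∀ u ∈ side L.graph v w, ∀ y, ∀ hy : L.graph.Adj u y,
        v ∈ side L.graph u y → Toward L (TP.mk x) u (Sum.inr ⟨y, hy⟩) := by
      intro u hu y hy hv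
      rw [hseg]
      refine (pos_toward u y hy v hv).combine (pos_weaklyToward hy ?_) (by linarith) hr0.le (by ring)
      by_cases e : w = u
      · exact Or.inl e
      · exact Or.inr (adj_mem_side L.isTree hy hv h e)
    have hall : ∀ i, i ∈ minDiff x c := by
      have hge : ∀ i, m ≤ c i - x i := by
        intro i
        by_cases hi : i ∈ I
        · have := hmin i hi
          simp only [hx, Pi.add_apply, Pi.smul_apply, Set.indicator_of_mem hi, smul_eq_mul]
          linarith
        · have := hout i hi
          simp only [hx, Pi.add_apply, Pi.smul_apply, Set.indicator_of_notMem hi, smul_zero]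
          linarith
      have hi₁x : i₁ ∈ minDiff x c := by
        intro l
        refine le_trans (le_of_eq ?_) (hge l)
        simp only [hx, Pi.add_apply, Pi.smul_apply, Set.indicator_of_mem hi₁, smul_eq_mul]
        linarith
      intro i
      by_cases hi : i ∈ I
      · exact hc.minDiff_beyond htri v w h hfar i₁ hi₁ i hi hi₁x
      · intro l
        refine le_trans (le_of_eq ?_) (hge l)
        simp only [hx, Pi.add_apply, Pi.smul_apply, Set.indicator_of_notMem hi, smul_zero]
        linarith [hout i hi]
    rw [mk_eq_of_minDiff_eq_univ hall, hseg]
    exact Or.inl ⟨v, w, h, 1 - s / t, s / t, by linarith, hr0.le, by ring, rfl⟩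
  -- Seen from `w` the leaves behind are still minimal, so the branch missing there does not lead
  -- back to `v`.
  · push Not at hst
    have hw : TP.mk (C.weight w) = TP.mk (C.weight v + t • I.indicator fun _ => 1) := by
      rw [mk_add, mk_smul, C.mk_weight, C.mk_weight, hpos]
    obtain ⟨r, hr⟩ := mk_eq_mk.1 hw
    have hge : ∀ i, m - r ≤ c i - C.weight w i := by
      intro i
      rw [hr i]
      by_cases hi : i ∈ I
      · have := hmin i hi
        simp only [Pi.add_apply, Pi.smul_apply, Set.indicator_of_mem hi, smul_eq_mul]
        linarith
      · have := hout i hi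
        simp only [Pi.add_apply, Pi.smul_apply, Set.indicator_of_notMem hi, smul_zero]
        linarith
    have hi₀w : i₀ ∈ minDiff (C.weight w) c := by
      intro l
      refine le_trans (le_of_eq ?_) (hge l)
      rw [hr i₀]
      simp only [Pi.add_apply, Pi.smul_apply, Set.indicator_of_notMem hi₀I, smul_zero]
      linarith
    rcases hc.minDiff_vertex htri w with hu | ⟨y, hy⟩
    · rw [mk_eq_of_minDiff_eq_univ hu, C.mk_weight]
      exact pos_mem_carrier htri w
    · have hy0 : y ≠ Sum.inr ⟨v, h.symm⟩ := by
        rintro rfl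
        exact (hy i₀).1 hi₀w (branchOf_eq_inr.2 hi₀)
      rcases y with j | ⟨w', hw'⟩
      · exact mem_carrier_of_ray hy htri
      · exact ih w' hw' (by rintro rfl; exact hy0 rfl) hw' hy

theorem OnAll.mem_carrier (htri : L.IsTrivalent) {c : Fin n → ℝ} (hc : C.OnAll c) :
    TP.mk c ∈ L.carrier := by
  obtain ⟨v⟩ := L.isTree.connected.nonempty
  rcases hc.minDiff_vertex htri v with hu | ⟨j | ⟨w, hw⟩, hy⟩
  · rw [mk_eq_of_minDiff_eq_univ hu, C.mk_weight]
    exact pos_mem_carrier htri v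
  · exact mem_carrier_of_ray hy htri
  · exact hc.mem_carrier_of_beyond htri v w hw hy

theorem onAll_of_weaklyToward (htri : L.IsTrivalent) {x : Fin n → ℝ}
    (h : ∀ u, ∃ y, WeaklyToward L (TP.mk x) u y) : C.OnAll x := by
  intro u
  obtain ⟨y, hy⟩ := h u
  obtain ⟨z, z', h1, h2, h3⟩ := exists_two_other htri y
  exact ⟨_, C.term_mem_minTerms hy h1.symm, _, C.term_mem_minTerms hy h2.symm,
    (C.term_injective u).ne h3⟩

/-- Seen from any vertex `u`, a point of the line lies weakly in the direction of a single branch,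
and the terms of the other two branches stay minimal. -/
theorem onAll_of_mem_carrier (htri : L.IsTrivalent) {x : Fin n → ℝ} (hx : TP.mk x ∈ L.carrier) :
    C.OnAll x := by
  refine onAll_of_weaklyToward htri fun u => ?_
  rcases hx with ⟨v, w, h, α, β, hα, hβ, hαβ, he⟩ | ⟨i, t, ht, he⟩
  · obtain ⟨y, h1, h2⟩ : ∃ y, WeaklyToward L (L.pos v) u y ∧ WeaklyToward L (L.pos w) u y := by
      by_cases huv : v = u
      · subst huv
        exact ⟨_, weaklyToward_self _ _, pos_weaklyToward h (Or.inr (self_mem_side _ _))⟩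
      · obtain ⟨y, hy, hv⟩ := exists_mem_side L.isTree huv
        refine ⟨_, pos_weaklyToward hy (Or.inr hv), pos_weaklyToward hy ?_⟩
        by_cases huw : w = u
        · exact Or.inl huw
        · exact Or.inr (adj_mem_side L.isTree hy hv h huw)
    exact ⟨y, he ▸ h1.combine h2 hα hβ hαβ⟩
  · obtain ⟨ξ, hξ, h0, h1⟩ := pos_leaf_weaklyToward (L := L) i u
    refine ⟨branchOf L u i, ξ + t • Pi.single i 1, ?_, fun l => ?_, fun l hl => ?_⟩
    · rw [he, hξ, mk_add, mk_smul, add_assoc]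
    · have := h0 l
      have : 0 ≤ (Pi.single i 1 : Fin n → ℝ) l := by
        by_cases e : l = i
        · subst e; simp
        · simp [e]
      simp only [Pi.add_apply, Pi.smul_apply, smul_eq_mul]
      positivity
    · have e : l ≠ i := by rintro rfl; exact hl rfl
      simp [h1 l hl, e]

/-- With the coefficients of `v`, the minimum at the point of `v` is attained by three terms, but at
the point of any other vertex by only two. -/
theorem mk_point_injective (htri : L.IsTrivalent) (hd : ∀ i, ∑ m, a i m = d) :
    Function.Injective fun v => TP.mk (C.point v) := by
  intro u v huv
  by_contra hne
  obtain ⟨y, hy, hv⟩ := exists_mem_side L.isTree (Ne.symm hne : v ≠ u)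
  have h1 : Toward L (TP.mk (C.weight v)) u (Sum.inr ⟨y, hy⟩) := by
    rw [C.mk_weight]
    exact pos_toward u y hy v hv
  have h2 : range (C.term v) ⊆ C.term u '' {z | z ≠ Sum.inr ⟨y, hy⟩} := by
    intro i hi
    rw [← C.minTerms_eq, ← minTerms_point_congr hd _ huv, C.mem_minTerms_iff htri h1] at hi
    exact hi
  have h3 := Set.ncard_le_ncard h2 (Set.toFinite _)
  rw [← Set.image_univ, Set.ncard_image_of_injective _ (C.term_injective v),
    Set.ncard_image_of_injective _ (C.term_injective u), Set.ncard_univ, card_branch htri] at h3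
  have h4 : {z : Branch L u | z ≠ Sum.inr ⟨y, hy⟩}.ncard < (univ : Set (Branch L u)).ncard :=
    Set.ncard_lt_ncard ⟨subset_univ _, fun h => h (mem_univ (Sum.inr ⟨y, hy⟩)) rfl⟩ (Set.toFinite _)
  rw [Set.ncard_univ, card_branch htri] at h4
  omega

/-- Filling in huge coefficients at `i` and `j` gives a full curve through all points for which
neither leaf is in the minimal set at the vertex of `i`. Only one branch can be missing there, and
the branch of `i` contains no other leaf. -/
theorem isGeneral (htri : L.IsTrivalent) (hd : ∀ i, ∑ m, a i m = d) {i j : Fin n} (hij : i ≠ j)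
    (c : Fin n → ℝ) : ¬ ∀ v, TP.mk (C.point v) ∈ tropCurve a {l | l ≠ i ∧ l ≠ j} c := by
  intro hall
  set v₀ := L.leaf i with hv₀
  obtain ⟨l₀, hl₀⟩ : ∃ l : Fin n, l ∉ ({i, j} : Finset (Fin n)) := by
    refine Finset.exists_mem_notMem_of_card_lt_card (s := {i, j}) (t := Finset.univ) ?_ |>.imp
      fun l hl => hl.2
    have := card_vertices htri
    have hV : 0 < Nat.card V := by
      have : Nonempty V := ⟨v₀⟩
      exact Nat.card_pos
    rw [Finset.card_pair hij, Finset.card_univ, Fintype.card_fin]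
    omega
  simp only [Finset.mem_insert, Finset.mem_singleton, not_or] at hl₀
  -- make the two missing coefficients large
  obtain ⟨R, hR1, hR2⟩ : ∃ R : ℝ, (∀ v k, ∀ l, tropTerm a c (C.point v) k ≤
      R + ∑ m, (a l m : ℝ) * C.point v m) ∧ ∀ l, c l₀ - C.weight v₀ l₀ < R - C.weight v₀ l := by
    have h1 : ∀ v k l, ∀ᶠ R : ℝ in atTop, tropTerm a c (C.point v) k ≤
        R + ∑ m, (a l m : ℝ) * C.point v m := fun v k l => by
      filter_upwards [eventually_ge_atTop (tropTerm a c (C.point v) k -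
        ∑ m, (a l m : ℝ) * C.point v m)] with R hR
      linarith
    have h2 : ∀ l, ∀ᶠ R : ℝ in atTop, c l₀ - C.weight v₀ l₀ < R - C.weight v₀ l := fun l => by
      filter_upwards [eventually_gt_atTop (c l₀ - C.weight v₀ l₀ + C.weight v₀ l)] with R hR
      linarith
    exact ((eventually_all.2 fun v => eventually_all.2 fun k => eventually_all.2 fun l =>
      h1 v k l).and (eventually_all.2 h2)).exists
  set c' : Fin n → ℝ := fun l => if l = i ∨ l = j then R else c l with hc'
  have hin : ∀ l, (l = i ∨ l = j) → c' l = R := fun l hl => by simp only [hc', if_pos hl]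
  have hout : ∀ l, l ≠ i → l ≠ j → c' l = c l := fun l h1 h2 => by
    simp only [hc', if_neg (not_or.2 ⟨h1, h2⟩)]
  have hterm : ∀ l, l ≠ i → l ≠ j → ∀ p, tropTerm a c' p l = tropTerm a c p l :=
    fun l h1 h2 p => by simp only [tropTerm, hout l h1 h2]
  have hon : C.OnAll c' := by
    intro v
    obtain ⟨k, hk, l, hl, hkl, he, hmin⟩ := (mem_tropCurve_iff hd).1 (hall v)
    have hle : ∀ r, tropTerm a c (C.point v) k ≤ tropTerm a c' (C.point v) r := by
      intro r
      by_cases hr : r = i ∨ r = j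
      · have := hR1 v k r
        exact this.trans_eq (by rw [tropTerm, hin r hr])
      · rw [not_or] at hr
        rw [hterm r hr.1 hr.2]
        exact hmin r hr
    refine ⟨k, fun r => ?_, l, fun r => ?_, hkl⟩
    · rw [hterm k hk.1 hk.2]
      exact hle r
    · rw [hterm l hl.1 hl.2, ← he]
      exact hle r
  have hnot : ∀ l, (l = i ∨ l = j) → l ∉ minDiff (C.weight v₀) c' := by
    intro l hl hM
    have h1 := hM l₀
    rw [hin l hl, hout l₀ hl₀.1 hl₀.2] at h1
    linarith [hR2 l]
  rcases hon.minDiff_vertex htri v₀ with hu | ⟨x, hx⟩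
  · exact hnot i (Or.inl rfl) (hu i)
  · have h1 : branchOf L v₀ i = x := by
      by_contra h
      exact hnot i (Or.inl rfl) ((hx i).2 h)
    have h2 : branchOf L v₀ j = x := by
      by_contra h
      exact hnot j (Or.inr rfl) ((hx j).2 h)
    have h3 : branchOf L v₀ i = Sum.inl ⟨i, rfl⟩ := branchOf_eq_inl.2 rfl
    exact hij (branchOf_eq_inl.1 (h2.trans (h1.symm.trans h3))).symm

end VertexPoints

end Pencil

/-! ### From the plane `r + s + t = d` to `ℝ × ℝ` -/

section Projection

variable {n d : ℕ} {a : Fin n → Fin 3 → ℕ}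

/-- The first two coordinates of the support. -/
def planePt (a : Fin n → Fin 3 → ℕ) (i : Fin n) : ℝ × ℝ := ((a i 0 : ℝ), (a i 1 : ℝ))

/-- The functional on the first two coordinates given by `p` on the plane `r + s + t = d`. -/
noncomputable def planeFunctional (p : Fin 3 → ℝ) : StrongDual ℝ (ℝ × ℝ) :=
  (p 0 - p 2) • ContinuousLinearMap.fst ℝ ℝ ℝ + (p 1 - p 2) • ContinuousLinearMap.snd ℝ ℝ ℝ

theorem planeFunctional_apply (p : Fin 3 → ℝ) (x : ℝ × ℝ) :
    planeFunctional p x = (p 0 - p 2) * x.1 + (p 1 - p 2) * x.2 := rfl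

theorem planeFunctional_surjective : Function.Surjective planeFunctional := by
  intro q
  refine ⟨![q (1, 0), q (0, 1), 0], ?_⟩
  refine ContinuousLinearMap.ext fun x => ?_
  rw [planeFunctional_apply]
  have : x = x.1 • ((1, 0) : ℝ × ℝ) + x.2 • ((0, 1) : ℝ × ℝ) := by ext <;> simp
  conv_rhs => rw [this, map_add, map_smul, map_smul]
  simp
  ring

/-- The parametrization of the plane `r + s + t = d` by the first two coordinates. -/
noncomputable def planeMap (d : ℕ) : ℝ × ℝ →ᵃ[ℝ] (Fin 3 → ℝ) where
  toFun x := ![x.1, x.2, d - x.1 - x.2]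
  linear :=
    { toFun := fun x => ![x.1, x.2, -x.1 - x.2]
      map_add' := fun x y => by ext m; fin_cases m <;> simp; ring
      map_smul' := fun t x => by ext m; fin_cases m <;> simp; ring }
  map_vadd' x y := by ext m; fin_cases m <;> simp; ring

theorem coord_two (hd : ∀ i, ∑ m, a i m = d) (i : Fin n) :
    (a i 2 : ℝ) = d - a i 0 - a i 1 := by
  rw [← hd i, Fin.sum_univ_three]
  push_cast
  ring

theorem planeMap_planePt (hd : ∀ i, ∑ m, a i m = d) (i : Fin n) :
    planeMap d (planePt a i) = realPt a i := by
  ext m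
  have := coord_two hd i
  fin_cases m
  · rfl
  · rfl
  · change (d : ℝ) - a i 0 - a i 1 = a i 2
    exact this.symm

theorem planeMap_injective (d : ℕ) : Function.Injective (planeMap d) := by
  intro x y h
  exact Prod.ext (congrFun h 0) (congrFun h 1)

theorem tropTerm_eq (hd : ∀ i, ∑ m, a i m = d) (c : Fin n → ℝ) (p : Fin 3 → ℝ) (i : Fin n) :
    tropTerm a c p i = c i + planeFunctional p (planePt a i) + d * p 2 := by
  rw [tropTerm, planeFunctional_apply, Fin.sum_univ_three, coord_two hd i]
  simp only [planePt]
  ring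

theorem minTerms_eq_cell (hd : ∀ i, ∑ m, a i m = d) (c : Fin n → ℝ) (p : Fin 3 → ℝ) :
    minTerms a c p = cell (planePt a) c (planeFunctional p) := by
  ext i
  simp [minTerms, cell, tropTerm_eq hd]

theorem convexHull_realPt (hd : ∀ i, ∑ m, a i m = d) (M : Set (Fin n)) :
    convexHull ℝ (realPt a '' M) = planeMap d '' convexHull ℝ (planePt a '' M) := by
  rw [AffineMap.image_convexHull, image_image]
  simp only [planeMap_planePt hd]

theorem maximalHeights_of_isMaximalSubdivision (hd : ∀ i, ∑ m, a i m = d) {c : Fin n → ℝ}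
    (h : IsMaximalSubdivision a c) : MaximalHeights (planePt a) c := by
  have hcell : ∀ c p, convexHull ℝ (realPt a '' minTerms a c p) =
      planeMap d '' convexHull ℝ (planePt a '' cell (planePt a) c (planeFunctional p)) :=
    fun c p => by rw [convexHull_realPt hd, minTerms_eq_cell hd]
  intro c' hc' q
  have heq := h c' (by
    rintro _ ⟨p', rfl⟩
    obtain ⟨q, hq⟩ := hc' (planeFunctional p')
    obtain ⟨p, rfl⟩ := planeFunctional_surjective q
    refine ⟨_, ⟨p, rfl⟩, ?_⟩
    rw [hcell, hcell]
    exact image_mono hq)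
  obtain ⟨p, rfl⟩ := planeFunctional_surjective q
  have hmem : convexHull ℝ (realPt a '' minTerms a c p) ∈ regularSubdivision a c' :=
    heq ▸ ⟨p, rfl⟩
  obtain ⟨p', hp'⟩ := hmem
  rw [hcell, hcell] at hp'
  exact ⟨planeFunctional p', ((planeMap_injective d).image_injective hp').symm⟩

/-- The constant `d * p 2` cancels in all comparisons, and the projected functional vanishes only
for constant `p`, which is zero in `TP 3`. -/
theorem hullEdge_of_isHullEdge (hd : ∀ i, ∑ m, a i m = d) {i j k l : Fin n}
    (h : IsHullEdge a i j k l) : HullEdge (planePt a) i j k l := by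
  obtain ⟨⟨p, hp, h1, h2, h3⟩, hk, hl⟩ := h
  have hdot : ∀ i, p ⬝ᵥ realPt a i = planeFunctional p (planePt a i) + d * p 2 := by
    intro i
    have := tropTerm_eq hd 0 p i
    simp only [tropTerm, Pi.zero_apply, zero_add] at this
    rw [← this]
    exact Finset.sum_congr rfl fun m _ => mul_comm _ _
  have hseg : ∀ r, realPt a r ∉ segment ℝ (realPt a i) (realPt a j) →
      planePt a r ∉ segment ℝ (planePt a i) (planePt a j) := by
    intro r hr hr'
    apply hr
    rw [← planeMap_planePt hd, ← planeMap_planePt hd, ← planeMap_planePt hd, ← image_segment]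
    exact mem_image_of_mem _ hr'
  rw [hdot, hdot] at h1 h2 h3
  refine ⟨⟨planeFunctional p, ?_, by linarith, by linarith, by linarith⟩, hseg k hk, hseg l hl⟩
  intro h0
  apply hp
  have e0 := congrArg (fun q : StrongDual ℝ (ℝ × ℝ) => q (1, 0)) h0
  have e1 := congrArg (fun q : StrongDual ℝ (ℝ × ℝ) => q (0, 1)) h0
  simp [planeFunctional_apply] at e0 e1
  refine (mk_eq_mk (y := 0)).2 ⟨p 2, fun m => ?_⟩
  fin_cases m
  · simp; linarith
  · simp; linarith
  · simp

theorem planePt_injective (ha : Function.Injective a) (hd : ∀ i, ∑ m, a i m = d) :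
    Function.Injective (planePt a) := by
  intro i j hij
  apply ha
  have h0 : (a i 0 : ℝ) = a j 0 := congrArg Prod.fst hij
  have h1 : (a i 1 : ℝ) = a j 1 := congrArg Prod.snd hij
  have h2 := coord_two hd i
  rw [h0, h1, ← coord_two hd j] at h2
  funext m
  fin_cases m
  · exact_mod_cast h0
  · exact_mod_cast h1
  · exact_mod_cast h2

theorem affineSpan_planePt (hd : ∀ i, ∑ m, a i m = d)
    (hdim : Module.finrank ℝ (vectorSpan ℝ (Set.range (realPt a))) = 2) :
    affineSpan ℝ (range (planePt a)) = ⊤ := by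
  have h1 : range (realPt a) = planeMap d '' range (planePt a) := by
    rw [← range_comp]
    congr 1
    ext1 i
    exact (planeMap_planePt hd i).symm
  rw [h1, ← AffineMap.map_vectorSpan] at hdim
  have h2 := Submodule.finrank_map_le (planeMap d).linear (vectorSpan ℝ (range (planePt a)))
  have h3 := Submodule.finrank_le (vectorSpan ℝ (range (planePt a)))
  have h4 : Module.finrank ℝ (ℝ × ℝ) = 2 := by simp
  have hne : (range (planePt a)).Nonempty := by
    by_contra h
    rw [Set.not_nonempty_iff_eq_empty] at h
    rw [h, vectorSpan_empty, Submodule.map_bot, finrank_bot] at hdim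
    omega
  rw [AffineSubspace.affineSpan_eq_top_iff_vectorSpan_eq_top_of_nonempty ℝ _ _ hne]
  exact Submodule.eq_top_of_finrank_eq (by omega)

end Projection

/-- Color the support by the branches at each vertex; the functional dual to a trichromatic triangle
gives the point. -/
theorem exists_vertexPoints {n d : ℕ} {a : Fin n → Fin 3 → ℕ} (ha : Function.Injective a)
    (hd : ∀ i, ∑ m, a i m = d)
    (hdim : Module.finrank ℝ (vectorSpan ℝ (Set.range (realPt a))) = 2)
    {V : Type*} [Finite V] (L : TropicalLine n V)
    (hcomp : L.IsCompatible a) (htri : L.IsTrivalent)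
    (hmax : ∀ (v : V) (c : Fin n → ℝ), TP.mk c = L.pos v → IsMaximalSubdivision a c) :
    Nonempty (VertexPoints a L) := by
  classical
  have hn : Nonempty (Fin n) := by
    have := card_vertices htri
    exact ⟨⟨0, by omega⟩⟩
  have hinj := planePt_injective ha hd
  have hspan := affineSpan_planePt hd hdim
  have hE : Module.finrank ℝ (ℝ × ℝ) = 2 := by simp
  choose W hW using fun v => exists_mk (L.pos v)
  have hvert : ∀ v, ∃ (p : Fin 3 → ℝ) (τ : Branch L v → Fin n),
      (∀ x, branchOf L v (τ x) = x) ∧ minTerms a (W v) p = range τ := by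
    intro v
    have hM := maximalHeights_of_isMaximalSubdivision hd (hmax v (W v) (hW v))
    let e := Finite.equivFinOfCardEq (card_branch htri v)
    have hκ : ColoringCompatible (planePt a) fun i => e (branchOf L v i) := by
      intro i i' j k hii hjk h hj hk
      have hq := isQuartet_of_branchOf hii hjk (e.injective h) (fun h' => hj (congrArg e h'))
        fun h' => hk (congrArg e h')
      exact (hcomp i i' j k hq).imp (hullEdge_of_isHullEdge hd) (hullEdge_of_isHullEdge hd)
    obtain ⟨q, hq⟩ := hκ.exists_trichromatic hM hE hinj hspan
      (e.surjective.comp (branchOf_surjective v))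
    obtain ⟨p, rfl⟩ := planeFunctional_surjective q
    choose τ hτ hτe using fun x => hq (e x)
    have hτb : ∀ x, branchOf L v (τ x) = x := fun x => e.injective (hτe x)
    refine ⟨p, τ, hτb, ?_⟩
    rw [minTerms_eq_cell hd]
    refine subset_antisymm (fun i hi => ?_) (range_subset_iff.2 hτ)
    by_contra hir
    -- A further minimal term would be a fourth vertex of a cell of a planar triangulation.
    have : Fintype (Branch L v) := Fintype.ofFinite _
    have h1 := hM.card_le hinj hspan hE (planeFunctional p) (insert i (Finset.univ.image τ)) (by
      intro l hl
      rw [Finset.mem_coe, Finset.mem_insert, Finset.mem_image] at hl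
      rcases hl with rfl | ⟨x, -, rfl⟩
      · exact hi
      · exact hτ x)
    rw [Finset.card_insert_of_notMem (by simpa using hir),
      Finset.card_image_of_injective _ (Function.LeftInverse.injective hτb), Finset.card_univ,
      ← Nat.card_eq_fintype_card, card_branch htri] at h1
    omega
  choose p τ hτ hmin using hvert
  exact ⟨⟨W, hW, p, τ, hτ, hmin⟩⟩

end TropicalPencil


open TropicalPencil in
theorem theorem2 {n d : ℕ} (a : Fin n → Fin 3 → ℕ) (ha : Function.Injective a)
    (hd : ∀ i, ∑ m, a i m = d)
    (hdim : Module.finrank ℝ (vectorSpan ℝ (Set.range (realPt a))) = 2)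
    {V : Type*} [Finite V] (L : TropicalLine n V)
    (hcomp : L.IsCompatible a) (htri : L.IsTrivalent)
    (hmax : ∀ (v : V) (c : Fin n → ℝ), TP.mk c = L.pos v → IsMaximalSubdivision a c) :
    ∃ P : Fin (n - 2) → TP 3, Function.Injective P ∧ IsGeneral a P ∧
      L.carrier = pencilThrough a P ∧ ∀ k, ∃ v, L.Corresponds a (P k) v := by
  obtain ⟨C⟩ := exists_vertexPoints ha hd hdim L hcomp htri hmax
  have hcard : Nat.card V = n - 2 := by
    have := card_vertices htri
    omega
  let e : V ≃ Fin (n - 2) := Finite.equivFinOfCardEq hcard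
  refine ⟨fun k => TP.mk (C.point (e.symm k)),
    (VertexPoints.mk_point_injective htri hd).comp e.symm.injective,
    fun i j hij c h => VertexPoints.isGeneral (C := C) htri hd hij c fun v => ?_, ?_,
    fun k => ⟨e.symm k, ?_⟩⟩
  · simpa using h (e v)
  · have hon : ∀ c, C.OnAll c ↔
        ∀ k, TP.mk (C.point (e.symm k)) ∈ tropCurve a Set.univ c := by
      intro c
      simp only [mem_tropCurve_univ_iff hd]
      exact ⟨fun h k => h _, fun h u => by simpa using h (e u)⟩
    ext x
    constructor
    · intro hx
      obtain ⟨c, rfl⟩ := exists_mk x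
      exact ⟨c, (hon c).1 (VertexPoints.onAll_of_mem_carrier htri hx), rfl⟩
    · rintro ⟨c, hc, rfl⟩
      exact ((hon c).2 hc).mem_carrier htri
  · set v := e.symm k
    obtain ⟨x⟩ := nonempty_branch htri v
    obtain ⟨y, z, hxy, hxz, hyz⟩ := exists_two_other htri x
    have hsep : ∀ {s t : Branch L v}, s ≠ t → L.Separates v (C.term v s) (C.term v t) :=
      fun hst => separates_of_branchOf_ne (by simpa only [C.branchOf_term] using hst)
    have hmem : ∀ s, C.term v s ∈ minTerms a (C.weight v) (C.point v) := fun s => by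
      rw [C.minTerms_eq]
      exact Set.mem_range_self s
    exact ⟨C.weight v, C.point v, C.mk_weight v, rfl, C.term v x, C.term v y, C.term v z,
      hsep hxy, hsep hxz, hsep hyz, hmem x, hmem y, hmem z⟩
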